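/- Let $M$ be a paracompact Hausdorff smooth manifold of dimension $n$ and let $A$ be a Weil algebra, i.e. a finite-dimensional commutative real algebra with unit, with a unique maximal ideal $\mathfrak m$, of codimension $1$ over $\mathbb R$. Let $M^A$ be the Weil bundle: the set of algebra morphisms $\xi:C^\infty(M)\to A$ for which there is $x\in M$ with $\xi(f)-f(x)\in\mathfrak m$ for all $f\in C^\infty(M)$, with its usual smooth structure, in which a chart $(U;x_1,\dots,x_n)$ of $M$ gives the chart $\xi\mapsto(\xi(x_1),\dots,\xi(x_n))\in A^n$ on the near points with origin $x$ in $U$. For $f\in C^\infty(M)$ let $f^A\in C^\infty(M^A,A)$, $f^A(\xi)=\xi(f)$. Let $\mathfrak X(M)$ be the $C^\infty(M)$-module of derivations of $C^\infty(M)$, and let $\mathfrak X(M^A)$ be the $C^\infty(M^A,A)$-module of vector fields on $M^A$, i.e. of linear maps $X:C^\infty(M)\to C^\infty(M^A,A)$ with $X(fg)=X(f)g^A+f^AX(g)$. The prolongation of $\theta\in\mathfrak X(M)$ is $\theta^A\in\mathfrak X(M^A)$, $\theta^A(f)=[\theta(f)]^A$. A differential form of degree $p\ge 0$ on $M$ is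 an alternating $C^\infty(M)$-multilinear map $\mathfrak X(M)^p\to C^\infty(M)$; a differential $A$-form of degree $p$ on $M^A$ is an alternating $C^\infty(M^A,A)$-multilinear map $\mathfrak X(M^A)^p\to C^\infty(M^A,A)$. Interior multiplication is $(i_X\eta)(X_1,\dots,X_{p-1})=\eta(X,X_1,\dots,X_{p-1})$ for $p\ge 1$, and $i_X\eta=0$ for $p=0$. Let $\omega$ be a differential form of degree $p\geq 0$ on $M$ and let $\theta$ be a vector field on $M$. Then there is a unique differential $A$-form $\omega^A$ of degree $p$ on $M^A$ with $$\omega^A(\theta_1^A,\dots,\theta_p^A)=[\omega(\theta_1,\dots,\theta_p)]^A\quad\text{for all }\theta_1,\dots,\theta_p\in\mathfrak X(M),$$ there is likewise a unique prolongation $(i_\theta\omega)^A$ of the form $i_\theta\omega$, and $$(i_\theta\omega)^A=i_{\theta^A}(\omega^A).$$ -/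

import Mathlib

open scoped Manifold ContDiff Topology

/-- A Weil algebra: a finite-dimensional commutative unital real algebra with a unique maximal
ideal, of codimension one over the reals. -/
class WeilAlgebra (A : Type*) [CommRing A] [Algebra ℝ A] : Prop where
  finiteDimensional : FiniteDimensional ℝ A
  isLocalRing : IsLocalRing A
  codim_one : Module.finrank ℝ (A ⧸ IsLocalRing.maximalIdeal A) = 1

attribute [instance] WeilAlgebra.finiteDimensional WeilAlgebra.isLocalRing

namespace WeilAlgebra

section
variable (A : Type*) [CommRing A] [Algebra ℝ A] [WeilAlgebra A]

theorem bijective_residue :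
    Function.Bijective (algebraMap ℝ (A ⧸ IsLocalRing.maximalIdeal A)) :=
  Algebra.finrank_eq_one_iff_bijective_algebraMap.mp codim_one

/-- The real part: the projection `A = ℝ ⊕ 𝔪 → ℝ`. -/
noncomputable def re : A →ₐ[ℝ] ℝ :=
  ((AlgEquiv.ofBijective (Algebra.ofId ℝ (A ⧸ IsLocalRing.maximalIdeal A))
    (bijective_residue A)).symm : _ →ₐ[ℝ] ℝ).comp
      (Ideal.Quotient.mkₐ ℝ (IsLocalRing.maximalIdeal A))

variable {A}

theorem re_eq_zero_iff {a : A} : re A a = 0 ↔ a ∈ IsLocalRing.maximalIdeal A := by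
  simp [re, Ideal.Quotient.eq_zero_iff_mem]

theorem re_algebraMap (r : ℝ) : re A (algebraMap ℝ A r) = r := by simp

theorem sub_mem_iff {a : A} {r : ℝ} :
    a - algebraMap ℝ A r ∈ IsLocalRing.maximalIdeal A ↔ re A a = r := by
  rw [← re_eq_zero_iff, map_sub, re_algebraMap, sub_eq_zero]

theorem exists_pow_eq_bot : ∃ N : ℕ, IsLocalRing.maximalIdeal A ^ N = ⊥ := by
  have : IsArtinianRing A := IsArtinianRing.of_finite ℝ A
  obtain ⟨N, hN⟩ := IsArtinianRing.isNilpotent_jacobson_bot (R := A)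
  exact ⟨N, by rw [← IsLocalRing.jacobson_eq_maximalIdeal ⊥ bot_ne_top]; exact hN⟩

theorem isUnit_of_re {a : A} (h : re A a ≠ 0) : IsUnit a := by
  by_contra h'
  exact h (re_eq_zero_iff.2 ((IsLocalRing.mem_maximalIdeal a).2 h'))

end

section
variable {A : Type*} [NormedCommRing A] [NormedAlgebra ℝ A]

theorem contDiff_re [WeilAlgebra A] : ContDiff ℝ ∞ (re A) :=
  (LinearMap.toContinuousLinearMap (re A).toLinearMap).contDiff

instance : ContMDiffRing 𝓘(ℝ, A) ∞ A :=
  { instNormedSpaceLieAddGroup with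
    contMDiff_mul := by
      rw [contMDiff_iff]
      refine ⟨continuous_mul, fun x y => ?_⟩
      simp only [mfld_simps, chartAt_self_eq]
      rw [contDiffOn_univ]
      exact contDiff_mul }
end
end WeilAlgebra

section Hadamard

theorem contDiff_integral_aux {E : Type} [NormedAddCommGroup E] [NormedSpace ℝ E]
    [FiniteDimensional ℝ E] (k : ℕ) :
    ∀ {F : Type} [NormedAddCommGroup F] [NormedSpace ℝ F] [CompleteSpace F]
      {f : E → ℝ → F}, ContDiff ℝ ∞ (Function.uncurry f) →
      ContDiff ℝ k (fun x => ∫ t in (0 : ℝ)..1, f x t) := by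
  induction k with
  | zero =>
    intro F _ _ _ f hf
    exact contDiff_zero.2
      (intervalIntegral.continuous_parametric_intervalIntegral_of_continuous' hf.continuous 0 1)
  | succ k ih =>
    intro F _ _ _ f hf
    have hft : ∀ t x, HasFDerivAt (fun y => f y t) (fderiv ℝ (fun y => f y t) x) x := fun t x =>
      ((hf.comp (contDiff_id.prodMk contDiff_const)).differentiable (by simp) x).hasFDerivAt
    have hg : ContDiff ℝ ∞ (Function.uncurry fun (x : E) (t : ℝ) =>
        fderiv ℝ (fun y => f y t) x) := by
      have h1 : ContDiff ℝ ∞ (Function.uncurry fun (p : E × ℝ) (y : E) => f y p.2) :=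
        hf.comp (contDiff_snd.prodMk (contDiff_snd.comp contDiff_fst))
      exact ContDiff.fderiv h1 contDiff_fst (m := ∞) (by simp)
    have key : ∀ x, HasFDerivAt (fun x => ∫ t in (0 : ℝ)..1, f x t)
        (∫ t in (0 : ℝ)..1, fderiv ℝ (fun y => f y t) x) x := by
      intro x
      have hc := hg.continuous
      obtain ⟨C, hC⟩ := ((isCompact_closedBall x 1).prod
        (isCompact_Icc (a := (0 : ℝ)) (b := 1))).exists_bound_of_continuousOn hc.continuousOn
      refine intervalIntegral.hasFDerivAt_integral_of_dominated_of_fderiv_le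
        (F' := fun x t => fderiv ℝ (fun y => f y t) x) (bound := fun _ => C)
        (Metric.closedBall_mem_nhds x one_pos) ?_ ?_ ?_ ?_ ?_ ?_
      · exact Filter.Eventually.of_forall fun y =>
          (hf.continuous.comp (continuous_const.prodMk continuous_id)).aestronglyMeasurable
      · exact (hf.continuous.comp (continuous_const.prodMk continuous_id)).intervalIntegrable _ _
      · exact (hc.comp (continuous_const.prodMk continuous_id)).aestronglyMeasurable
      · refine Filter.Eventually.of_forall fun t ht y hy => ?_
        rw [Set.uIoc_of_le zero_le_one] at ht
        exact hC (y, t) ⟨hy, ht.1.le, ht.2⟩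
      · exact intervalIntegrable_const
      · exact Filter.Eventually.of_forall fun t _ y _ => hft t y
    push_cast
    rw [contDiff_succ_iff_fderiv]
    refine ⟨fun x => (key x).differentiableAt, by simp, ?_⟩
    rw [show fderiv ℝ (fun x => ∫ t in (0 : ℝ)..1, f x t) =
      fun x => ∫ t in (0 : ℝ)..1, fderiv ℝ (fun y => f y t) x from funext fun x => (key x).fderiv]
    exact ih hg

/-- A smooth function on `ℝⁿ` differs from its value at `y` by a combination of the coordinate
functions centred at `y` with smooth coefficients. -/
theorem exists_smooth_sub_eq {n : ℕ} {F : EuclideanSpace ℝ (Fin n) → ℝ} (hF : ContDiff ℝ ∞ F)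
    (y : EuclideanSpace ℝ (Fin n)) :
    ∃ G : Fin n → EuclideanSpace ℝ (Fin n) → ℝ, (∀ i, ContDiff ℝ ∞ (G i)) ∧
      ∀ x, F x = F y + ∑ i, (x i - y i) * G i x := by
  have hdir : ∀ i, ContDiff ℝ ∞ (Function.uncurry fun (x : EuclideanSpace ℝ (Fin n)) (t : ℝ) =>
      fderiv ℝ F (y + t • (x - y)) (EuclideanSpace.single i 1)) := by
    intro i
    have h1 : ContDiff ℝ ∞ (fderiv ℝ F) := hF.fderiv_right (by simp)
    have h2 : ContDiff ℝ ∞ fun p : EuclideanSpace ℝ (Fin n) × ℝ => y + p.2 • (p.1 - y) := by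
      fun_prop
    exact (h1.comp h2).clm_apply contDiff_const
  refine ⟨fun i x => ∫ t in (0 : ℝ)..1,
    fderiv ℝ F (y + t • (x - y)) (EuclideanSpace.single i 1), fun i => ?_, fun x => ?_⟩
  · exact contDiff_infty.2 fun k => contDiff_integral_aux k (hdir i)
  · have hd : ∀ t : ℝ, HasDerivAt (fun t : ℝ => F (y + t • (x - y)))
        (fderiv ℝ F (y + t • (x - y)) (x - y)) t := by
      intro t
      have h1 : HasDerivAt (fun t : ℝ => y + t • (x - y)) (x - y) t := by
        simpa using ((hasDerivAt_id t).smul_const (x - y)).const_add y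
      exact ((hF.differentiable (by simp) _).hasFDerivAt).comp_hasDerivAt t h1
    have hx : x - y = ∑ i, (x i - y i) • EuclideanSpace.single i (1 : ℝ) := by
      ext j
      simp [Finset.sum_apply, Pi.single_apply]
    have hexp : ∀ t : ℝ, fderiv ℝ F (y + t • (x - y)) (x - y) =
        ∑ i, (x i - y i) * fderiv ℝ F (y + t • (x - y)) (EuclideanSpace.single i 1) := by
      intro t
      conv_lhs => rw [show fderiv ℝ F (y + t • (x - y)) (x - y) =
        fderiv ℝ F (y + t • (x - y)) (∑ i, (x i - y i) • EuclideanSpace.single i (1 : ℝ)) by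
          rw [← hx]]
      simp
    have hcont : ∀ i, Continuous fun t : ℝ =>
        fderiv ℝ F (y + t • (x - y)) (EuclideanSpace.single i 1) := fun i =>
      (hdir i).continuous.comp (continuous_const.prodMk continuous_id)
    have hint := intervalIntegral.integral_eq_sub_of_hasDerivAt (a := 0) (b := 1)
      (fun t _ => hd t) (by
        simp_rw [hexp]
        exact (continuous_finsetSum _ fun i _ =>
          continuous_const.mul (hcont i)).intervalIntegrable _ _)
    simp_rw [hexp] at hint
    have hii : ∀ i, IntervalIntegrable (fun t : ℝ => (x i - y i) *
        fderiv ℝ F (y + t • (x - y)) (EuclideanSpace.single i 1)) MeasureTheory.volume 0 1 :=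
      fun i => (continuous_const.mul (hcont i)).intervalIntegrable _ _
    rw [intervalIntegral.integral_finsetSum (fun i _ => hii i)] at hint
    simp only [intervalIntegral.integral_const_mul] at hint
    simp only [one_smul, zero_smul, add_zero, add_sub_cancel] at hint
    rw [hint]; ring

end Hadamard

section WeilEvaluation

variable (n : ℕ) (A : Type*) [NormedCommRing A] [NormedAlgebra ℝ A]

/-- The algebra of smooth `A`-valued functions on `ℝⁿ`. -/
def smoothAValued : Subalgebra A (EuclideanSpace ℝ (Fin n) → A) where
  carrier := {f | ContDiff ℝ ∞ f}
  mul_mem' {f g} (hf : ContDiff ℝ ∞ f) (hg : ContDiff ℝ ∞ g) := hf.mul hg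
  add_mem' {f g} (hf : ContDiff ℝ ∞ f) (hg : ContDiff ℝ ∞ g) := hf.add hg
  algebraMap_mem' c := (contDiff_const : ContDiff ℝ ∞ fun _ => c)

variable {n A}

theorem smoothAValued_contDiff (f : smoothAValued n A) : ContDiff ℝ ∞ f.1 := f.2

/-- The directional derivative `∑ i, ν i ∂ᵢ` along `ν ∈ Aⁿ`. -/
noncomputable def weilDir (ν : Fin n → A) : smoothAValued n A →ₗ[A] smoothAValued n A where
  toFun f := ⟨fun x => ∑ i, ν i * fderiv ℝ f.1 x (EuclideanSpace.single i 1),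
    ContDiff.sum fun _ _ => contDiff_const.mul
      (((smoothAValued_contDiff f).fderiv_right (m := ∞) (by simp)).clm_apply contDiff_const)⟩
  map_add' f g := by
    ext x
    have hf := (smoothAValued_contDiff f).differentiable (by simp) x
    have hg := (smoothAValued_contDiff g).differentiable (by simp) x
    simp [fderiv_add hf hg, mul_add, Finset.sum_add_distrib]
  map_smul' c f := by
    ext x
    have hf := (smoothAValued_contDiff f).differentiable (by simp) x
    have : fderiv ℝ (c • f.1) x = c • fderiv ℝ f.1 x := fderiv_const_smul hf c
    simp [this, Finset.mul_sum, mul_left_comm]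

theorem weilDir_apply (ν : Fin n → A) (f : smoothAValued n A) (x) :
    (weilDir ν f).1 x = ∑ i, ν i * fderiv ℝ f.1 x (EuclideanSpace.single i 1) := rfl

theorem weilDir_mul (ν : Fin n → A) (f g : smoothAValued n A) :
    weilDir ν (f * g) = f * weilDir ν g + weilDir ν f * g := by
  ext x
  have hf := (smoothAValued_contDiff f).differentiable (by simp) x
  have hg := (smoothAValued_contDiff g).differentiable (by simp) x
  have : fderiv ℝ (f.1 * g.1) x = _ := fderiv_mul hf hg
  simp only [weilDir_apply, MulMemClass.coe_mul, this, Subalgebra.coe_add, Pi.add_apply,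
    Pi.mul_apply, Finset.mul_sum, Finset.sum_mul, ← Finset.sum_add_distrib]
  refine Finset.sum_congr rfl fun i _ => ?_
  simp
  ring

theorem weilDir_const (ν : Fin n → A) (f : smoothAValued n A) (c : A) (h : ∀ x, f.1 x = c) :
    weilDir ν f = 0 := by
  ext x
  rw [weilDir_apply, show f.1 = fun _ => c from funext h]
  simp

variable [WeilAlgebra A]

theorem range_weilDir_pow (ν : Fin n → A) (hν : ∀ i, ν i ∈ IsLocalRing.maximalIdeal A) (k : ℕ) :
    LinearMap.range (weilDir ν ^ k) ≤
      (IsLocalRing.maximalIdeal A) ^ k • (⊤ : Submodule A (smoothAValued n A)) := by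
  have h1 : LinearMap.range (weilDir ν) ≤
      IsLocalRing.maximalIdeal A • (⊤ : Submodule A (smoothAValued n A)) := by
    rintro _ ⟨f, rfl⟩
    have : weilDir ν f = ∑ i, ν i • (⟨fun x => fderiv ℝ f.1 x (EuclideanSpace.single i 1),
        ((smoothAValued_contDiff f).fderiv_right (m := ∞) (by simp)).clm_apply contDiff_const⟩ : smoothAValued n A) := by
      ext x
      simp [weilDir_apply, AddSubmonoidClass.coe_finsetSum]
    rw [this]
    exact Submodule.sum_mem _ fun i _ => Submodule.smul_mem_smul (hν i) trivial
  induction k with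
  | zero => rw [pow_zero, pow_zero, Ideal.one_eq_top, Submodule.top_smul]; exact le_top
  | succ k ih =>
    rw [pow_succ', Module.End.mul_eq_comp, LinearMap.range_comp]
    refine (Submodule.map_mono ih).trans ?_
    rw [Submodule.map_smul'', Submodule.map_top, pow_succ, Submodule.mul_smul]
    exact Submodule.smul_mono le_rfl h1

theorem weilDir_pow_eq_zero {N : ℕ} (hN : IsLocalRing.maximalIdeal A ^ N = ⊥) (ν : Fin n → A)
    (hν : ∀ i, ν i ∈ IsLocalRing.maximalIdeal A) : weilDir ν ^ N = 0 := by
  have := range_weilDir_pow ν hν N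
  rw [hN, Submodule.bot_smul, le_bot_iff, LinearMap.range_eq_bot] at this
  exact this

variable (A) in
/-- A real function regarded as an `A`-valued function. -/
noncomputable def weilConst (F : EuclideanSpace ℝ (Fin n) → ℝ) (hF : ContDiff ℝ ∞ F) : smoothAValued n A :=
  ⟨fun x => algebraMap ℝ A (F x), (algebraMapCLM ℝ A).contDiff.comp hF⟩

/-- The nilpotent part of a point of `Aⁿ`. -/
noncomputable def weilNil (a : Fin n → A) (i : Fin n) : A := a i - algebraMap ℝ A (WeilAlgebra.re A (a i))

theorem weilNil_mem (a : Fin n → A) (i : Fin n) : weilNil a i ∈ IsLocalRing.maximalIdeal A :=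
  WeilAlgebra.sub_mem_iff.2 rfl

/-- The real part of a point of `Aⁿ`, as a point of `ℝⁿ`. -/
noncomputable def weilRe (a : Fin n → A) : EuclideanSpace ℝ (Fin n) :=
  WithLp.toLp 2 fun i => WeilAlgebra.re A (a i)

theorem contDiff_weilRe : ContDiff ℝ ∞ (weilRe : (Fin n → A) → _) := by
  rw [contDiff_euclidean]
  intro i
  exact WeilAlgebra.contDiff_re.comp (contDiff_apply ℝ A i)

theorem contDiff_weilNil (i : Fin n) : ContDiff ℝ ∞ fun a : Fin n → A => weilNil a i :=
  (contDiff_apply ℝ A i).sub ((algebraMapCLM ℝ A).contDiff.comp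
    (WeilAlgebra.contDiff_re.comp (contDiff_apply ℝ A i)))

/-- The value at `a ∈ Aⁿ` of the prolongation of a smooth function `F` on `ℝⁿ`: its Taylor
expansion at the real part of `a`, evaluated at the nilpotent part of `a`. -/
noncomputable def weilTaylor (a : Fin n → A) (F : smoothAValued n A) : A :=
  ∑ k ∈ Finset.range (Classical.choose (WeilAlgebra.exists_pow_eq_bot (A := A))),
    ((k.factorial : ℝ)⁻¹) • ((weilDir (weilNil a) ^ k) F).1 (weilRe a)

theorem weilTaylor_mul (a : Fin n → A) (F G : smoothAValued n A) :
    weilTaylor a (F * G) = weilTaylor a F * weilTaylor a G := by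
  let _ : Algebra ℚ A := ((algebraMap ℝ A).comp (algebraMap ℚ ℝ)).toAlgebra
  set N := Classical.choose (WeilAlgebra.exists_pow_eq_bot (A := A)) with hN
  have h0 : weilDir (weilNil a) ^ N = 0 := weilDir_pow_eq_zero
    (Classical.choose_spec (WeilAlgebra.exists_pow_eq_bot (A := A))) _ (weilNil_mem a)
  have key : ∀ F : smoothAValued n A, weilTaylor a F =
      (IsNilpotent.exp (weilDir (weilNil a)) F).1 (weilRe a) := by
    intro F
    rw [IsNilpotent.exp_eq_sum h0]
    simp only [weilTaylor, LinearMap.sum_apply, AddSubmonoidClass.coe_finsetSum, Finset.sum_apply]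
    refine Finset.sum_congr rfl fun k _ => ?_
    rw [LinearMap.smul_apply]
    change _ = ((k.factorial : ℚ)⁻¹) • (((weilDir (weilNil a) ^ k) F).1 (weilRe a))
    rw [Algebra.smul_def, Algebra.smul_def]
    congr 1
    simp [RingHom.algebraMap_toAlgebra]
  rw [key, key, key, Module.End.exp_mul_of_derivation A (smoothAValued n A) _
    (weilDir_mul _) ⟨N, h0⟩]
  rfl

theorem weilTaylor_add (a : Fin n → A) (F G : smoothAValued n A) :
    weilTaylor a (F + G) = weilTaylor a F + weilTaylor a G := by
  simp [weilTaylor, Finset.sum_add_distrib]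

theorem weilTaylor_smul (a : Fin n → A) (c : A) (F : smoothAValued n A) :
    weilTaylor a (c • F) = c * weilTaylor a F := by
  simp [weilTaylor, Finset.mul_sum]

theorem weilTaylor_eq_of_sq (a : Fin n → A) (F : smoothAValued n A)
    (h : weilDir (weilNil a) (weilDir (weilNil a) F) = 0) :
    weilTaylor a F = F.1 (weilRe a) + (weilDir (weilNil a) F).1 (weilRe a) := by
  set N := Classical.choose (WeilAlgebra.exists_pow_eq_bot (A := A)) with hN
  have h0 : weilDir (weilNil a) ^ N = 0 := weilDir_pow_eq_zero
    (Classical.choose_spec (WeilAlgebra.exists_pow_eq_bot (A := A))) _ (weilNil_mem a)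
  have h1 : weilTaylor a F = ∑ k ∈ Finset.range (N + 2),
      ((k.factorial : ℝ)⁻¹) • ((weilDir (weilNil a) ^ k) F).1 (weilRe a) := by
    rw [weilTaylor, ← hN, Finset.sum_range_succ, Finset.sum_range_succ, pow_succ, h0]
    simp
  rw [h1, Finset.sum_range_succ', Finset.sum_range_succ', Finset.sum_eq_zero]
  · simp [add_comm]
  · intro k _
    have : (weilDir (weilNil a) ^ (k + 1 + 1)) F = 0 := by
      rw [pow_succ, pow_succ, Module.End.mul_apply, Module.End.mul_apply, h, map_zero]
    rw [this]; simp

theorem weilTaylor_sub_mem (a : Fin n → A) (F : smoothAValued n A) :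
    weilTaylor a F - F.1 (weilRe a) ∈ IsLocalRing.maximalIdeal A := by
  set N := Classical.choose (WeilAlgebra.exists_pow_eq_bot (A := A)) with hN
  have h0 : weilDir (weilNil a) ^ N = 0 := weilDir_pow_eq_zero
    (Classical.choose_spec (WeilAlgebra.exists_pow_eq_bot (A := A))) _ (weilNil_mem a)
  have h1 : weilTaylor a F = ∑ k ∈ Finset.range (N + 1),
      ((k.factorial : ℝ)⁻¹) • ((weilDir (weilNil a) ^ k) F).1 (weilRe a) := by
    rw [weilTaylor, ← hN, Finset.sum_range_succ, h0]
    simp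
  rw [h1, Finset.sum_range_succ']
  simp only [pow_zero, Nat.factorial_zero, Nat.cast_one, inv_one, one_smul, Module.End.one_apply,
    add_sub_cancel_right]
  refine Ideal.sum_mem _ fun k _ => ?_
  rw [pow_succ', Module.End.mul_apply, Algebra.smul_def]
  refine Ideal.mul_mem_left _ _ ?_
  rw [weilDir_apply]
  refine Ideal.sum_mem _ fun i _ => ?_
  exact Ideal.mul_mem_right _ _ (weilNil_mem a i)

theorem weilTaylor_one (a : Fin n → A) : weilTaylor a (1 : smoothAValued n A) = 1 := by
  have h := weilDir_const (weilNil a) (1 : smoothAValued n A) 1 fun _ => rfl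
  rw [weilTaylor_eq_of_sq _ _ (by rw [h, map_zero]), h]
  simp

theorem weilTaylor_coord (a : Fin n → A) (j : Fin n) (hj) :
    weilTaylor a (weilConst A (fun x : EuclideanSpace ℝ (Fin n) => x j) hj) = a j := by
  have h1 : ∀ x, (weilDir (weilNil a)
      (weilConst A (fun x : EuclideanSpace ℝ (Fin n) => x j) hj)).1 x = weilNil a j := by
    intro x
    have h2 : HasFDerivAt (weilConst A (fun x : EuclideanSpace ℝ (Fin n) => x j) hj).1
        ((algebraMapCLM ℝ A).comp (EuclideanSpace.proj j :
          EuclideanSpace ℝ (Fin n) →L[ℝ] ℝ)) x :=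
      ((algebraMapCLM ℝ A).comp (EuclideanSpace.proj j :
          EuclideanSpace ℝ (Fin n) →L[ℝ] ℝ)).hasFDerivAt
    rw [weilDir_apply, h2.fderiv]
    simp
  rw [weilTaylor_eq_of_sq _ _ (weilDir_const _ _ _ h1), h1]
  simp [weilConst, weilRe, weilNil]

theorem contDiff_weilTaylor (F : smoothAValued n A) :
    ContDiff ℝ ∞ fun a : Fin n → A => weilTaylor a F := by
  have key : ∀ k : ℕ, ContDiff ℝ ∞ fun p : (Fin n → A) × EuclideanSpace ℝ (Fin n) =>
      ((weilDir (weilNil p.1) ^ k) F).1 p.2 := by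
    intro k
    induction k with
    | zero => exact (smoothAValued_contDiff F).comp contDiff_snd
    | succ k ih =>
      simp_rw [pow_succ', Module.End.mul_apply, weilDir_apply]
      refine ContDiff.sum fun i _ => ((contDiff_weilNil i).comp contDiff_fst).mul ?_
      refine ContDiff.clm_apply ?_ contDiff_const
      refine ContDiff.fderiv (m := ∞) (n := ∞)
        (f := fun (p : (Fin n → A) × EuclideanSpace ℝ (Fin n)) y =>
          ((weilDir (weilNil p.1) ^ k) F).1 y) ?_ contDiff_snd (by simp)
      exact ih.comp ((contDiff_fst.comp contDiff_fst).prodMk contDiff_snd)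
  unfold weilTaylor
  refine ContDiff.sum fun k _ => ContDiff.const_smul _ ?_
  exact (key k).comp (contDiff_id.prodMk contDiff_weilRe)

end WeilEvaluation

/-- The algebra `C^∞(M)` of smooth real functions on an `n`-dimensional manifold. -/
abbrev SmoothFun (n : ℕ) (M : Type*) [TopologicalSpace M]
    [ChartedSpace (EuclideanSpace ℝ (Fin n)) M] : Type _ := C^∞⟮𝓡 n, M; 𝓘(ℝ, ℝ), ℝ⟯

/-- The set `M^A` of near points of kind `A` on `M`: algebra morphisms `ξ : C^∞(M) → A` for which
there is a point `x` of `M` with `ξ f - f x` in the maximal ideal for all `f`. -/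
@[ext]
structure WeilBundle (n : ℕ) (M : Type*) [TopologicalSpace M]
    [ChartedSpace (EuclideanSpace ℝ (Fin n)) M]
    (A : Type*) [CommRing A] [Algebra ℝ A] [WeilAlgebra A] where
  toAlgHom : SmoothFun n M →ₐ[ℝ] A
  exists_base : ∃ x : M, ∀ f : SmoothFun n M,
    toAlgHom f - algebraMap ℝ A (f x) ∈ IsLocalRing.maximalIdeal A

section Bump

variable {n : ℕ} {M : Type*} [TopologicalSpace M] [ChartedSpace (EuclideanSpace ℝ (Fin n)) M]

/-- `f` is smooth on a neighbourhood of `x`. -/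
def SmoothNear {M' E' : Type*} [TopologicalSpace M'] [NormedAddCommGroup E'] [NormedSpace ℝ E']
    [ChartedSpace E' M'] (f : M → M') (x : M) : Prop :=
  ∀ᶠ y in 𝓝 x, ContMDiffAt (𝓡 n) 𝓘(ℝ, E') ∞ f y

variable [IsManifold (𝓡 n) ∞ M] [T2Space M]

theorem exists_bump {s : Set M} {x : M} (hs : s ∈ 𝓝 x) :
    ∃ ρ : SmoothFun n M, ρ =ᶠ[𝓝 x] 1 ∧ tsupport ρ ⊆ s := by
  obtain ⟨ρ, -, hρ⟩ := (SmoothBumpFunction.nhds_basis_tsupport (I := 𝓡 n) x).mem_iff.1 hs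
  exact ⟨⟨ρ, ρ.contMDiff⟩, ρ.eventuallyEq_one, hρ⟩

theorem exists_smooth_eventuallyEq {f : M → ℝ} {x : M} (hf : SmoothNear (n := n) (E' := ℝ) f x) :
    ∃ g : SmoothFun n M, g =ᶠ[𝓝 x] f := by
  obtain ⟨ρ, h1, h2⟩ := exists_bump (n := n) hf
  refine ⟨⟨fun y => ρ y * f y, contMDiff_of_tsupport fun y hy => ?_⟩, ?_⟩
  · have hy' : y ∈ tsupport ρ := tsupport_mul_subset_left hy
    exact (ρ.contMDiff y).mul (h2 hy')
  · filter_upwards [h1] with y hy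
    change ρ y * f y = f y
    rw [hy]; simp

theorem eq_of_forall_smooth_eq {x y : M} (h : ∀ f : SmoothFun n M, f x = f y) : x = y := by
  by_contra hxy
  obtain ⟨ρ, h1, h2⟩ := exists_bump (n := n) (isOpen_compl_singleton.mem_nhds hxy)
  have h3 : ρ y = 0 := by
    by_contra h3
    exact h2 (subset_tsupport _ h3) rfl
  have := h ρ
  rw [h1.eq_of_nhds, h3] at this
  simp at this

end Bump

namespace WeilBundle

variable {n : ℕ} {M : Type*} [TopologicalSpace M] [ChartedSpace (EuclideanSpace ℝ (Fin n)) M]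
  {M' : Type*} [TopologicalSpace M'] [ChartedSpace (EuclideanSpace ℝ (Fin n)) M']

theorem smoothNear_comp {h : M → M'} {x : M}
    (hh : SmoothNear (n := n) (E' := EuclideanSpace ℝ (Fin n)) h x) {f : M' → ℝ}
    (hf : SmoothNear (n := n) (E' := ℝ) f (h x)) : SmoothNear (n := n) (E' := ℝ) (f ∘ h) x := by
  have hc : ContinuousAt h x := hh.self_of_nhds.continuousAt
  filter_upwards [hh, hc.eventually hf] with y h1 h2
  exact ContMDiffAt.comp y h2 h1

theorem smoothNear_coe (f : SmoothFun n M) (x : M) : SmoothNear (n := n) (E' := ℝ) f x :=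
  Filter.Eventually.of_forall fun y => f.contMDiff y

section
variable {A : Type*} [CommRing A] [Algebra ℝ A] [WeilAlgebra A]

/-- The origin `π(ξ)` of a near point. -/
noncomputable def base (ξ : WeilBundle n M A) : M := ξ.exists_base.choose

theorem re_apply (ξ : WeilBundle n M A) (f : SmoothFun n M) :
    WeilAlgebra.re A (ξ.toAlgHom f) = f ξ.base :=
  WeilAlgebra.sub_mem_iff.1 (ξ.exists_base.choose_spec f)

open Classical in
/-- The value of a near point `ξ` on a real function `f` which is only smooth near the origin of
`ξ`: the value of `ξ` on any smooth function on `M` with the same germ. -/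
noncomputable def germ (ξ : WeilBundle n M A) (f : M → ℝ) : A :=
  if h : ∃ g : SmoothFun n M, g =ᶠ[𝓝 ξ.base] f then ξ.toAlgHom h.choose else 0

variable [IsManifold (𝓡 n) ∞ M] [T2Space M]

theorem base_eq (ξ : WeilBundle n M A) {x : M}
    (h : ∀ f : SmoothFun n M, WeilAlgebra.re A (ξ.toAlgHom f) = f x) : ξ.base = x :=
  eq_of_forall_smooth_eq fun f => by rw [← h f, re_apply]

theorem congr_germ (ξ : WeilBundle n M A) {f g : SmoothFun n M} (h : f =ᶠ[𝓝 ξ.base] g) :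
    ξ.toAlgHom f = ξ.toAlgHom g := by
  obtain ⟨ρ, h1, h2⟩ := exists_bump (n := n) h
  have h3 : ρ * (f - g) = 0 := by
    ext y
    change ρ y * (f y - g y) = 0
    by_cases hy : y ∈ tsupport ρ
    · rw [show f y = g y from h2 hy]; simp
    · rw [image_eq_zero_of_notMem_tsupport hy]; simp
  have h4 : IsUnit (ξ.toAlgHom ρ) := WeilAlgebra.isUnit_of_re (by
    rw [re_apply, h1.eq_of_nhds]; simp)
  have h5 : ξ.toAlgHom ρ * (ξ.toAlgHom f - ξ.toAlgHom g) = 0 := by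
    rw [← map_sub, ← map_mul, h3, map_zero]
  exact sub_eq_zero.1 (h4.mul_right_eq_zero.1 h5)

theorem germ_eq (ξ : WeilBundle n M A) {f : M → ℝ} {g : SmoothFun n M}
    (h : g =ᶠ[𝓝 ξ.base] f) : ξ.germ f = ξ.toAlgHom g := by
  have hex : ∃ g : SmoothFun n M, g =ᶠ[𝓝 ξ.base] f := ⟨g, h⟩
  rw [germ, dif_pos hex]
  exact ξ.congr_germ (hex.choose_spec.trans h.symm)

theorem germ_coe (ξ : WeilBundle n M A) (g : SmoothFun n M) : ξ.germ g = ξ.toAlgHom g :=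
  ξ.germ_eq Filter.EventuallyEq.rfl

theorem germ_congr (ξ : WeilBundle n M A) {f f' : M → ℝ} (h : f =ᶠ[𝓝 ξ.base] f') :
    ξ.germ f = ξ.germ f' := by
  by_cases hex : ∃ g : SmoothFun n M, g =ᶠ[𝓝 ξ.base] f
  · obtain ⟨g, hg⟩ := hex
    rw [ξ.germ_eq hg, ξ.germ_eq (hg.trans h)]
  · have hex' : ¬ ∃ g : SmoothFun n M, g =ᶠ[𝓝 ξ.base] f' := fun ⟨g, hg⟩ =>
      hex ⟨g, hg.trans h.symm⟩
    rw [germ, germ, dif_neg hex, dif_neg hex']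

variable [IsManifold (𝓡 n) ∞ M'] [T2Space M']

/-- The image of a near point of `M` under a map `h` to `M'` which is smooth near its origin. -/
noncomputable def push (ξ : WeilBundle n M A) (h : M → M')
    (hh : SmoothNear (n := n) (E' := EuclideanSpace ℝ (Fin n)) h ξ.base) :
    WeilBundle n M' A where
  toAlgHom := AlgHom.ofLinearMap
    { toFun g := ξ.germ (g ∘ h)
      map_add' f g := by
        obtain ⟨f', hf⟩ := exists_smooth_eventuallyEq (smoothNear_comp hh (smoothNear_coe f _))
        obtain ⟨g', hg⟩ := exists_smooth_eventuallyEq (smoothNear_comp hh (smoothNear_coe g _))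
        rw [ξ.germ_eq hf, ξ.germ_eq hg, ← map_add]
        exact ξ.germ_eq (hf.add hg)
      map_smul' c f := by
        obtain ⟨f', hf⟩ := exists_smooth_eventuallyEq (smoothNear_comp hh (smoothNear_coe f _))
        rw [ξ.germ_eq hf, ← map_smul]
        exact ξ.germ_eq (hf.const_smul c) }
    (by
      rw [← map_one ξ.toAlgHom, ← ξ.germ_coe]; rfl)
    (fun f g => by
      obtain ⟨f', hf⟩ := exists_smooth_eventuallyEq (smoothNear_comp hh (smoothNear_coe f _))
      obtain ⟨g', hg⟩ := exists_smooth_eventuallyEq (smoothNear_comp hh (smoothNear_coe g _))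
      change ξ.germ _ = ξ.germ _ * ξ.germ _
      rw [ξ.germ_eq hf, ξ.germ_eq hg, ← map_mul]
      exact ξ.germ_eq (hf.mul hg))
  exists_base := ⟨h ξ.base, fun f => by
    obtain ⟨f', hf⟩ := exists_smooth_eventuallyEq (smoothNear_comp hh (smoothNear_coe f _))
    change ξ.germ (f ∘ h) - _ ∈ _
    rw [WeilAlgebra.sub_mem_iff, ξ.germ_eq hf, re_apply, hf.eq_of_nhds]; rfl⟩

theorem push_apply (ξ : WeilBundle n M A) (h : M → M') (hh) (g : SmoothFun n M') :
    (ξ.push h hh).toAlgHom g = ξ.germ (g ∘ h) := rfl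

theorem base_push (ξ : WeilBundle n M A) (h : M → M') (hh) : (ξ.push h hh).base = h ξ.base := by
  refine base_eq _ fun f => ?_
  obtain ⟨f', hf⟩ := exists_smooth_eventuallyEq (smoothNear_comp hh (smoothNear_coe f _))
  rw [push_apply, ξ.germ_eq hf, re_apply, hf.eq_of_nhds]; rfl

theorem germ_push (ξ : WeilBundle n M A) (h : M → M') (hh) {f : M' → ℝ}
    (hf : SmoothNear (n := n) (E' := ℝ) f (h ξ.base)) :
    (ξ.push h hh).germ f = ξ.germ (f ∘ h) := by
  obtain ⟨g, hg⟩ := exists_smooth_eventuallyEq hf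
  have hg' : g =ᶠ[𝓝 (ξ.push h hh).base] f := by rw [base_push]; exact hg
  rw [germ_eq _ hg', push_apply]
  exact ξ.germ_congr (hh.self_of_nhds.continuousAt.eventually hg)

end

section Euclid
variable {A : Type*} [NormedCommRing A] [NormedAlgebra ℝ A] [WeilAlgebra A]

/-- The near point of `ℝⁿ` with coordinates `a ∈ Aⁿ`. -/
noncomputable def eucl (a : Fin n → A) : WeilBundle n (EuclideanSpace ℝ (Fin n)) A where
  toAlgHom := AlgHom.ofLinearMap
    { toFun F := weilTaylor a (weilConst A F F.contMDiff.contDiff)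
      map_add' F G := by
        rw [← weilTaylor_add]
        congr 1
        ext x
        exact map_add (algebraMap ℝ A) (F x) (G x)
      map_smul' c F := by
        rw [RingHom.id_apply, Algebra.smul_def c (weilTaylor a _), ← weilTaylor_smul]
        congr 1
        ext x
        exact map_mul (algebraMap ℝ A) c (F x) }
    (by
      change weilTaylor a _ = 1
      rw [← weilTaylor_one a]
      congr 1
      ext x
      exact map_one (algebraMap ℝ A))
    (fun F G => by
      change weilTaylor a _ = weilTaylor a _ * weilTaylor a _
      rw [← weilTaylor_mul]
      congr 1
      ext x
      exact map_mul (algebraMap ℝ A) (F x) (G x))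
  exists_base := ⟨weilRe a, fun F => weilTaylor_sub_mem a _⟩

theorem eucl_apply (a : Fin n → A) (F : SmoothFun n (EuclideanSpace ℝ (Fin n))) :
    (eucl a).toAlgHom F = weilTaylor a (weilConst A F F.contMDiff.contDiff) := rfl

theorem base_eucl (a : Fin n → A) : (eucl a).base = weilRe a :=
  base_eq _ fun _ => WeilAlgebra.sub_mem_iff.1 (weilTaylor_sub_mem a _)

theorem contDiff_eucl_apply (F : SmoothFun n (EuclideanSpace ℝ (Fin n))) :
    ContDiff ℝ ∞ fun a : Fin n → A => (eucl a).toAlgHom F := contDiff_weilTaylor _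

/-- The coordinate functions of `ℝⁿ`. -/
def coordFun (i : Fin n) : SmoothFun n (EuclideanSpace ℝ (Fin n)) :=
  ⟨fun x => x i, ((EuclideanSpace.proj i : EuclideanSpace ℝ (Fin n) →L[ℝ] ℝ).contDiff).contMDiff⟩

theorem eucl_coordFun (a : Fin n → A) (i : Fin n) : (eucl a).toAlgHom (coordFun i) = a i :=
  weilTaylor_coord a i _

/-- A near point of `ℝⁿ` is determined by its coordinates. -/
theorem ext_euclid {ξ ξ' : WeilBundle n (EuclideanSpace ℝ (Fin n)) A}
    (h : ∀ i, ξ.toAlgHom (coordFun i) = ξ'.toAlgHom (coordFun i)) : ξ = ξ' := by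
  have hb : ξ.base = ξ'.base := by
    ext i
    have h1 := ξ.re_apply (coordFun i)
    have h2 := ξ'.re_apply (coordFun i)
    rw [h i, h2] at h1
    exact h1.symm
  have key : ∀ (k : ℕ) (F : SmoothFun n (EuclideanSpace ℝ (Fin n))),
      ξ.toAlgHom F - ξ'.toAlgHom F ∈ IsLocalRing.maximalIdeal A ^ k := by
    intro k
    induction k with
    | zero => intro F; simp
    | succ k ih =>
      intro F
      obtain ⟨G, hG, hF⟩ := exists_smooth_sub_eq F.contMDiff.contDiff ξ.base
      let G' : Fin n → SmoothFun n (EuclideanSpace ℝ (Fin n)) := fun i => ⟨G i, (hG i).contMDiff⟩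
      have hF' : F = algebraMap ℝ _ (F ξ.base) +
          ∑ i, (coordFun i - algebraMap ℝ _ (ξ.base i)) * G' i := by
        ext x
        have h1 : (∑ i, (coordFun i - algebraMap ℝ _ (ξ.base i)) * G' i :
            SmoothFun n (EuclideanSpace ℝ (Fin n))) x = ∑ i, (x i - ξ.base i) * G i x := by
          have := map_sum (ContMDiffMap.evalRingHom (I := 𝓡 n) (I' := 𝓘(ℝ, ℝ)) (n := ∞) (R := ℝ) x)
            (fun i => (coordFun i - algebraMap ℝ _ (ξ.base i)) * G' i) Finset.univ
          exact this
        change F x = F ξ.base + _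
        rw [h1]
        exact hF x
      rw [hF']
      simp only [map_add, AlgHom.commutes, map_sum, map_mul, map_sub, h, add_sub_add_left_eq_sub,
        ← Finset.sum_sub_distrib, ← mul_sub]
      refine Ideal.sum_mem _ fun i _ => ?_
      rw [pow_succ']
      refine Ideal.mul_mem_mul ?_ (ih _)
      rw [WeilAlgebra.sub_mem_iff, re_apply, hb]
      rfl
  obtain ⟨N, hN⟩ := WeilAlgebra.exists_pow_eq_bot (A := A)
  ext F
  have := key N F
  rw [hN] at this
  exact sub_eq_zero.1 this

end Euclid

section Charts
variable {A : Type*} [NormedCommRing A] [NormedAlgebra ℝ A] [WeilAlgebra A]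
  [IsManifold (𝓡 n) ∞ M]

theorem smoothNear_chart {x₀ x : M} (hx : x ∈ (chartAt (EuclideanSpace ℝ (Fin n)) x₀).source) :
    SmoothNear (n := n) (E' := EuclideanSpace ℝ (Fin n))
      (chartAt (EuclideanSpace ℝ (Fin n)) x₀) x := by
  filter_upwards [(chartAt (EuclideanSpace ℝ (Fin n)) x₀).open_source.mem_nhds hx] with y hy
  exact (contMDiffOn_chart (I := 𝓡 n)).contMDiffAt
    ((chartAt (EuclideanSpace ℝ (Fin n)) x₀).open_source.mem_nhds hy)

theorem smoothNear_chart_symm {x₀ : M} {y : EuclideanSpace ℝ (Fin n)}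
    (hy : y ∈ (chartAt (EuclideanSpace ℝ (Fin n)) x₀).target) :
    SmoothNear (n := n) (E' := EuclideanSpace ℝ (Fin n))
      (chartAt (EuclideanSpace ℝ (Fin n)) x₀).symm y := by
  filter_upwards [(chartAt (EuclideanSpace ℝ (Fin n)) x₀).open_target.mem_nhds hy] with z hz
  exact (contMDiffOn_chart_symm (I := 𝓡 n)).contMDiffAt
    ((chartAt (EuclideanSpace ℝ (Fin n)) x₀).open_target.mem_nhds hz)

/-- The near point of `M` at `x` given by evaluation at `x`. -/
noncomputable def pointEval (A : Type*) [CommRing A] [Algebra ℝ A] [WeilAlgebra A] (x : M) :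
    WeilBundle n M A where
  toAlgHom := (Algebra.ofId ℝ A).comp
    (AlgHom.ofLinearMap { toFun := fun f : SmoothFun n M => f x, map_add' := fun _ _ => rfl, map_smul' := fun _ _ => rfl }
      rfl (fun _ _ => rfl))
  exists_base := ⟨x, fun f => by
    change algebraMap ℝ A (f x) - _ ∈ _
    simp⟩

theorem smoothNear_chart_coord {x₀ x : M}
    (hx : x ∈ (chartAt (EuclideanSpace ℝ (Fin n)) x₀).source) (i : Fin n) :
    SmoothNear (n := n) (E' := ℝ) (fun y => chartAt (EuclideanSpace ℝ (Fin n)) x₀ y i) x :=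
  smoothNear_comp (smoothNear_chart hx) (smoothNear_coe (coordFun i) _)

variable [T2Space M]

theorem push_chart_coordFun (ξ : WeilBundle n M A) {x₀ : M}
    (h : ξ.base ∈ (chartAt (EuclideanSpace ℝ (Fin n)) x₀).source) (i : Fin n) :
    (ξ.push _ (smoothNear_chart h)).toAlgHom (coordFun i) =
      ξ.germ fun y => chartAt (EuclideanSpace ℝ (Fin n)) x₀ y i := rfl

theorem weilRe_chart (ξ : WeilBundle n M A) {x₀ : M}
    (h : ξ.base ∈ (chartAt (EuclideanSpace ℝ (Fin n)) x₀).source) :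
    (weilRe fun i => ξ.germ fun y => chartAt (EuclideanSpace ℝ (Fin n)) x₀ y i) =
      chartAt (EuclideanSpace ℝ (Fin n)) x₀ ξ.base := by
  ext i
  rw [← base_push ξ (chartAt (EuclideanSpace ℝ (Fin n)) x₀) (smoothNear_chart h)]
  exact re_apply (ξ.push _ (smoothNear_chart h)) (coordFun i)

theorem eucl_chart (ξ : WeilBundle n M A) {x₀ : M}
    (h : ξ.base ∈ (chartAt (EuclideanSpace ℝ (Fin n)) x₀).source) :
    (eucl fun i => ξ.germ fun y => chartAt (EuclideanSpace ℝ (Fin n)) x₀ y i) =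
      ξ.push _ (smoothNear_chart h) :=
  ext_euclid fun i => by rw [eucl_coordFun, push_chart_coordFun ξ h]

open Classical in
/-- The chart of `M^A` associated with the chart `φ = (x₁, …, xₙ)` of `M` around `x₀`: it is defined
over the domain of `φ`, and sends `ξ` to `(ξ(x₁), …, ξ(xₙ)) ∈ Aⁿ`. -/
noncomputable def weilChart (x₀ : M) : PartialEquiv (WeilBundle n M A) (Fin n → A) where
  toFun ξ i := ξ.germ fun y => chartAt (EuclideanSpace ℝ (Fin n)) x₀ y i
  invFun a := if h : weilRe a ∈ (chartAt (EuclideanSpace ℝ (Fin n)) x₀).target then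
    (eucl a).push (chartAt (EuclideanSpace ℝ (Fin n)) x₀).symm
      (smoothNear_chart_symm (by rw [base_eucl]; exact h))
    else pointEval A x₀
  source := {ξ | ξ.base ∈ (chartAt (EuclideanSpace ℝ (Fin n)) x₀).source}
  target := {a | weilRe a ∈ (chartAt (EuclideanSpace ℝ (Fin n)) x₀).target}
  map_source' ξ hξ := by
    change weilRe (fun i => ξ.germ fun y => chartAt (EuclideanSpace ℝ (Fin n)) x₀ y i) ∈
      (chartAt (EuclideanSpace ℝ (Fin n)) x₀).target
    rw [weilRe_chart ξ hξ]
    exact OpenPartialHomeomorph.map_source _ hξ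
  map_target' a ha := by
    have ha' : weilRe a ∈ (chartAt (EuclideanSpace ℝ (Fin n)) x₀).target := ha
    rw [dif_pos ha']
    change (push _ _ _).base ∈ (chartAt (EuclideanSpace ℝ (Fin n)) x₀).source
    rw [base_push, base_eucl]
    exact OpenPartialHomeomorph.map_target _ ha
  left_inv' ξ hξ := by
    have h1 : weilRe (fun i => ξ.germ fun y => chartAt (EuclideanSpace ℝ (Fin n)) x₀ y i) ∈
        (chartAt (EuclideanSpace ℝ (Fin n)) x₀).target := by
      rw [weilRe_chart ξ hξ]
      exact OpenPartialHomeomorph.map_source _ hξ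
    rw [dif_pos h1]
    ext f
    rw [push_apply]
    have h2 : (eucl fun i => ξ.germ fun y => chartAt (EuclideanSpace ℝ (Fin n)) x₀ y i).germ
        (f ∘ (chartAt (EuclideanSpace ℝ (Fin n)) x₀).symm) =
        (ξ.push _ (smoothNear_chart hξ)).germ
          (f ∘ (chartAt (EuclideanSpace ℝ (Fin n)) x₀).symm) := by rw [eucl_chart ξ hξ]
    rw [h2, germ_push, ← ξ.germ_coe]
    · refine ξ.germ_congr ?_
      filter_upwards [(chartAt (EuclideanSpace ℝ (Fin n)) x₀).open_source.mem_nhds hξ] with y hy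
      simp [OpenPartialHomeomorph.left_inv _ hy]
    · exact smoothNear_comp (smoothNear_chart_symm (OpenPartialHomeomorph.map_source _ hξ))
        (smoothNear_coe f _)
  right_inv' a ha := by
    have ha' : weilRe a ∈ (chartAt (EuclideanSpace ℝ (Fin n)) x₀).target := ha
    rw [dif_pos ha']
    funext i
    have hb : (chartAt (EuclideanSpace ℝ (Fin n)) x₀).symm (eucl a).base ∈
        (chartAt (EuclideanSpace ℝ (Fin n)) x₀).source := by
      rw [base_eucl]; exact OpenPartialHomeomorph.map_target _ ha
    rw [germ_push _ _ _ (smoothNear_chart_coord hb i), ← eucl_coordFun a i]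
    refine germ_eq _ ?_
    have ht : (eucl a).base ∈ (chartAt (EuclideanSpace ℝ (Fin n)) x₀).target := by
      rw [base_eucl]; exact ha
    filter_upwards [(chartAt (EuclideanSpace ℝ (Fin n)) x₀).open_target.mem_nhds ht] with y hy
    simp only [Function.comp_apply, OpenPartialHomeomorph.right_inv _ hy]
    rfl

theorem weilChart_symm_apply {x₀ : M} {a : Fin n → A}
    (h : weilRe a ∈ (chartAt (EuclideanSpace ℝ (Fin n)) x₀).target) :
    (weilChart x₀).symm a = (eucl a).push (chartAt (EuclideanSpace ℝ (Fin n)) x₀).symm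
      (smoothNear_chart_symm (by rw [base_eucl]; exact h)) := dif_pos h

theorem base_weilChart_symm {x₀ : M} {a : Fin n → A}
    (h : weilRe a ∈ (chartAt (EuclideanSpace ℝ (Fin n)) x₀).target) :
    ((weilChart x₀).symm a).base = (chartAt (EuclideanSpace ℝ (Fin n)) x₀).symm (weilRe a) := by
  rw [weilChart_symm_apply h, base_push, base_eucl]

/-- In a chart of `M^A`, the map `ξ ↦ ξ(f)` is smooth wherever `f` is. -/
theorem contDiffAt_germ_weilChart_symm {x₀ : M} {a₀ : Fin n → A} {f : M → ℝ}
    (h : weilRe a₀ ∈ (chartAt (EuclideanSpace ℝ (Fin n)) x₀).target)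
    (hf : SmoothNear (n := n) (E' := ℝ) f
      ((chartAt (EuclideanSpace ℝ (Fin n)) x₀).symm (weilRe a₀))) :
    ContDiffAt ℝ ∞ (fun a : Fin n → A => ((weilChart x₀).symm a).germ f) a₀ := by
  obtain ⟨G, hG⟩ := exists_smooth_eventuallyEq (smoothNear_comp (smoothNear_chart_symm h) hf)
  have hcont : ContinuousAt (weilRe : (Fin n → A) → _) a₀ := contDiff_weilRe.continuous.continuousAt
  have hcont' : ContinuousAt (chartAt (EuclideanSpace ℝ (Fin n)) x₀).symm (weilRe a₀) :=
    (chartAt (EuclideanSpace ℝ (Fin n)) x₀).continuousAt_symm h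
  refine (contDiff_eucl_apply G).contDiffAt.congr_of_eventuallyEq ?_
  filter_upwards [hcont.eventually (eventually_eventually_nhds.2 hG),
    hcont.eventually ((chartAt (EuclideanSpace ℝ (Fin n)) x₀).open_target.mem_nhds h),
    hcont.eventually (hcont'.eventually (eventually_eventually_nhds.2 hf))] with a h1 h2 h3
  rw [weilChart_symm_apply h2, germ_push]
  · refine germ_eq _ ?_
    rw [base_eucl]
    exact h1
  · rw [base_eucl]
    exact h3

theorem weilChart_trans_source (x₀ x₁ : M) :
    ((weilChart (n := n) (A := A) x₀).symm.trans (weilChart x₁)).source =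
      weilRe ⁻¹' ((chartAt (EuclideanSpace ℝ (Fin n)) x₀).symm.trans
        (chartAt (EuclideanSpace ℝ (Fin n)) x₁)).source := by
  ext a
  simp only [PartialEquiv.trans_source, PartialEquiv.symm_source, Set.mem_inter_iff,
    Set.mem_preimage, OpenPartialHomeomorph.trans_source, OpenPartialHomeomorph.symm_source]
  refine and_congr_right fun h => ?_
  change ((weilChart x₀).symm a).base ∈ (chartAt (EuclideanSpace ℝ (Fin n)) x₁).source ↔ _
  rw [base_weilChart_symm h]

theorem contDiffOn_weilChart_trans (x₀ x₁ : M) :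
    ContDiffOn ℝ ∞ ((weilChart (n := n) (A := A) x₀).symm.trans (weilChart x₁))
      ((weilChart (n := n) (A := A) x₀).symm.trans (weilChart x₁)).source := by
  intro a ha
  rw [weilChart_trans_source] at ha
  refine ContDiffAt.contDiffWithinAt (contDiffAt_pi.2 fun i => ?_)
  exact contDiffAt_germ_weilChart_symm ha.1 (smoothNear_chart_coord ha.2 i)

variable (n M A) in
/-- The atlas of `M^A`, modelled on `Aⁿ`. -/
noncomputable def weilCore : ChartedSpaceCore (Fin n → A) (WeilBundle n M A) where
  atlas := Set.range weilChart
  chartAt ξ := weilChart ξ.base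
  mem_chart_source ξ := mem_chart_source (EuclideanSpace ℝ (Fin n)) ξ.base
  chart_mem_atlas ξ := ⟨ξ.base, rfl⟩
  open_source := by
    rintro _ _ ⟨x₀, rfl⟩ ⟨x₁, rfl⟩
    rw [weilChart_trans_source]
    exact (OpenPartialHomeomorph.open_source _).preimage (contDiff_weilRe (A := A)).continuous
  continuousOn_toFun := by
    rintro _ _ ⟨x₀, rfl⟩ ⟨x₁, rfl⟩
    exact (contDiffOn_weilChart_trans x₀ x₁).continuousOn

noncomputable instance : TopologicalSpace (WeilBundle n M A) := (weilCore n M A).toTopologicalSpace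

noncomputable instance : ChartedSpace (Fin n → A) (WeilBundle n M A) :=
  (weilCore n M A).toChartedSpace

instance : IsManifold 𝓘(ℝ, Fin n → A) ∞ (WeilBundle n M A) := by
  refine isManifold_of_contDiffOn _ _ _ ?_
  intro e e' he he'
  obtain ⟨_, ⟨_, rfl⟩, _, ⟨⟨x₀, rfl⟩, rfl⟩, rfl⟩ := he
  obtain ⟨_, ⟨_, rfl⟩, _, ⟨⟨x₁, rfl⟩, rfl⟩, rfl⟩ := he'
  exact (contDiffOn_weilChart_trans (A := A) x₀ x₁).mono (fun a ha => ha.1)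

/-- The prolongation `f^A` of a smooth function `f`, a smooth map from `M^A` to `A`. -/
theorem contMDiff_prolong (f : SmoothFun n M) :
    ContMDiff 𝓘(ℝ, Fin n → A) 𝓘(ℝ, A) ∞ fun ξ : WeilBundle n M A => ξ.toAlgHom f := by
  intro ξ
  have h1 : ContMDiffAt 𝓘(ℝ, Fin n → A) 𝓘(ℝ, Fin n → A) ∞ (chartAt (Fin n → A) ξ) ξ :=
    (contMDiffOn_chart (I := 𝓘(ℝ, Fin n → A))).contMDiffAt
      ((chartAt (Fin n → A) ξ).open_source.mem_nhds (mem_chart_source _ ξ))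
  have h2 : ContDiffAt ℝ ∞ (fun a : Fin n → A => ((weilChart ξ.base).symm a).germ f)
      (weilChart ξ.base ξ) :=
    contDiffAt_germ_weilChart_symm
      ((weilChart (A := A) ξ.base).map_source (mem_chart_source _ ξ.base)) (smoothNear_coe f _)
  refine (ContMDiffAt.comp ξ (g := fun a : Fin n → A => ((weilChart ξ.base).symm a).germ f)
    h2.contMDiffAt h1).congr_of_eventuallyEq ?_
  filter_upwards [(chartAt (Fin n → A) ξ).open_source.mem_nhds (mem_chart_source _ ξ)] with η hη
  change _ = ((weilChart ξ.base).symm (weilChart ξ.base η)).germ f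
  rw [(weilChart ξ.base).left_inv hη, germ_coe]

variable (n M A) in
/-- The algebra `C^∞(M^A, A)` of smooth `A`-valued functions on `M^A`. -/
abbrev SmoothFunA : Type _ := C^∞⟮𝓘(ℝ, Fin n → A), WeilBundle n M A; 𝓘(ℝ, A), A⟯

/-- The prolongation `f ↦ f^A`, `f^A(ξ) = ξ(f)`, as a morphism of algebras
`C^∞(M) → C^∞(M^A, A)`. -/
noncomputable def prolongFun : SmoothFun n M →ₐ[ℝ] SmoothFunA n M A :=
  AlgHom.ofLinearMap
    { toFun f := ⟨fun ξ => ξ.toAlgHom f, contMDiff_prolong f⟩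
      map_add' f g := by ext ξ; exact map_add ξ.toAlgHom f g
      map_smul' c f := by ext ξ; exact map_smul ξ.toAlgHom c f }
    (by ext ξ; exact map_one ξ.toAlgHom)
    (fun f g => by ext ξ; exact map_mul ξ.toAlgHom f g)

/-- `C^∞(M^A, A)` is an algebra over `C^∞(M)` through `f ↦ f^A`, so `f • φ = f^A * φ`. -/
noncomputable instance : Algebra (SmoothFun n M) (SmoothFunA n M A) :=
  (prolongFun : SmoothFun n M →ₐ[ℝ] SmoothFunA n M A).toRingHom.toAlgebra

end Charts

end WeilBundle

section Forms

variable (n : ℕ) (M : Type*) [TopologicalSpace M] [ChartedSpace (EuclideanSpace ℝ (Fin n)) M]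

/-- Vector fields on `M`, as derivations of `C^∞(M)`. -/
abbrev VField : Type _ := Derivation ℝ (SmoothFun n M) (SmoothFun n M)

/-- Differential forms of degree `p` on `M`, as alternating `C^∞(M)`-multilinear forms on the
module of vector fields. -/
abbrev DForm (p : ℕ) : Type _ := VField n M [⋀^Fin p]→ₗ[SmoothFun n M] SmoothFun n M

variable [IsManifold (𝓡 n) ∞ M] [T2Space M]
  (A : Type*) [NormedCommRing A] [NormedAlgebra ℝ A] [WeilAlgebra A]

/-- Vector fields on `M^A`, as linear maps `X : C^∞(M) → C^∞(M^A, A)` with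
`X (f * g) = X f * g^A + f^A * X g`. They form a module over `C^∞(M^A, A)`. -/
abbrev VFieldA : Type _ := Derivation ℝ (SmoothFun n M) (WeilBundle.SmoothFunA n M A)

/-- Differential `A`-forms of degree `p` on `M^A`: alternating `C^∞(M^A, A)`-multilinear forms on
the module of vector fields on `M^A`, with values in `C^∞(M^A, A)`. -/
abbrev DFormA (p : ℕ) : Type _ := VFieldA n M A [⋀^Fin p]→ₗ[WeilBundle.SmoothFunA n M A] WeilBundle.SmoothFunA n M A

variable {n M A}

theorem VFieldA_leibniz (X : VFieldA n M A) (f g : SmoothFun n M) :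
    X (f * g) = X f * WeilBundle.prolongFun g + WeilBundle.prolongFun f * X g := by
  rw [X.leibniz, Algebra.smul_def, Algebra.smul_def, add_comm, mul_comm _ (X f)]
  rfl

/-- The prolongation `θ^A` of a vector field `θ` on `M`: the vector field `f ↦ (θ f)^A` on `M^A`. -/
noncomputable def prolongVField (θ : VField n M) : VFieldA n M A :=
  Derivation.mk' (WeilBundle.prolongFun.toLinearMap ∘ₗ θ.toLinearMap) (fun f g => by
    simp [Algebra.smul_def, RingHom.algebraMap_toAlgebra])

theorem prolongVField_apply (θ : VField n M) (f : SmoothFun n M) :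
    (prolongVField θ : VFieldA n M A) f = WeilBundle.prolongFun (θ f) := rfl

/-- Interior multiplication `i_X η` of alternating forms by `X`: it is `η(X, ·, …, ·)` in positive
degree, and zero on forms of degree zero. -/
def interiorMul {R V W : Type*} [CommRing R] [AddCommGroup V] [Module R V] [AddCommGroup W]
    [Module R W] (X : V) : {p : ℕ} → (V [⋀^Fin p]→ₗ[R] W) → (V [⋀^Fin (p - 1)]→ₗ[R] W)
  | 0, _ => 0
  | _ + 1, η => η.curryLeft X

/-- `η` is a prolongation of the `p`-form `α` to `M^A`:
`η(θ₁^A, …, θₚ^A) = (α(θ₁, …, θₚ))^A` for all vector fields `θ₁, …, θₚ` on `M`. -/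
def IsProlongForm {p : ℕ} (α : DForm n M p) (η : DFormA n M A p) : Prop :=
  ∀ θ : Fin p → VField n M,
    η (fun i => prolongVField (θ i)) = WeilBundle.prolongFun (α θ)

variable (A) in
open Classical in
/-- The prolongation `α^A` of a differential form `α` on `M` (the unique `A`-form with the property
`IsProlongForm`). -/
noncomputable def prolongForm {p : ℕ} (α : DForm n M p) : DFormA n M A p :=
  if h : ∃ η : DFormA n M A p, IsProlongForm α η then h.choose else 0

end Forms

/-!
Both sides of the asserted identity are prolongations of `i_θ α`, so the theorem follows from the
existence and the uniqueness of prolongations.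

Both are local questions. Around a point of `M` there are coordinates `xᵢ` and vector fields `eᵢ`
dual to them, which can be cut off so as to be globally defined (`LocalFrame`). A vector field `X`
on `M^A`, evaluated at a near point `ξ`, is a derivation `D` of `C^∞(M)` into `A` over `ξ`.
By Hadamard's lemma, such a derivation which vanishes on the coordinates has values in every power
of the maximal ideal `𝔪` of `A`, hence is zero because `𝔪` is nilpotent
(`WeilBundle.IsDerivOver.eq_zero`). Therefore `D f = ∑ D(xᵢ) ξ(eᵢ f)`, that is, over the domain of
the frame, `X = ∑ X(xᵢ) eᵢ^A`.

Multiplying by bump functions, an `A`-form `η` satisfies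
`η(X₁, …, Xₚ)(ξ) = ∑_I ∏ₖ Xₖ(x_{I k})(ξ) η(e_I^A)(ξ)` (`LocalFrame.DFormA_apply_eq_sum`), so that it
is determined by its values on prolonged vector fields. Conversely
`∑_I ∏ₖ Xₖ(x_{I k}) α(e_I)^A` is an alternating form which prolongs `α` over the domain of the frame
(`LocalFrame.localForm`), and by the same formula it does not depend on the frame there. The local
forms glue, pointwise in `ξ`, to a prolongation of `α`; no partition of unity is needed.
-/

/-! ### Local frames of vector fields -/

section LocalFrame

variable {n : ℕ} {M : Type*} [TopologicalSpace M] [ChartedSpace (EuclideanSpace ℝ (Fin n)) M]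

theorem SmoothFun.sum_apply {ι : Type*} (s : Finset ι) (g : ι → SmoothFun n M) (x : M) :
    (∑ i ∈ s, g i) x = ∑ i ∈ s, g i x :=
  map_sum (ContMDiffMap.evalRingHom (I := 𝓡 n) (I' := 𝓘(ℝ, ℝ)) (n := ∞) (R := ℝ) x) g s

variable (n M) in
/-- Coordinates and a coordinate frame over an open set `dom` of `M`, both extended to globally
defined objects: functions `coord i` on `M` and vector fields `vf i` on `M` which are dual to each
other over `dom`, such that Hadamard's lemma holds for `coord` at the points of `dom`. -/
structure LocalFrame where
  dom : Set M
  isOpen_dom : IsOpen dom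
  coord : Fin n → SmoothFun n M
  vf : Fin n → VField n M
  vf_coord : ∀ y ∈ dom, ∀ i j, vf i (coord j) y = if i = j then 1 else 0
  hadamard : ∀ y ∈ dom, ∀ f : SmoothFun n M, ∃ g : Fin n → SmoothFun n M,
    f =ᶠ[𝓝 y] (algebraMap ℝ (SmoothFun n M) (f y) +
      ∑ i, (coord i - algebraMap ℝ (SmoothFun n M) (coord i y)) * g i : SmoothFun n M)

variable [IsManifold (𝓡 n) ∞ M]

theorem differentiableAt_comp_chart_symm (f : SmoothFun n M) {x₀ y : M}
    (hy : y ∈ (chartAt (EuclideanSpace ℝ (Fin n)) x₀).source) :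
    DifferentiableAt ℝ (f ∘ (chartAt (EuclideanSpace ℝ (Fin n)) x₀).symm)
      (chartAt (EuclideanSpace ℝ (Fin n)) x₀ y) :=
  ((WeilBundle.smoothNear_comp (WeilBundle.smoothNear_chart_symm
    (OpenPartialHomeomorph.map_source _ hy))
      (WeilBundle.smoothNear_coe f _)).self_of_nhds.contDiffAt).differentiableAt (by simp)

/-- The `i`-th partial derivative in a chart of a smooth function is smooth over the chart. -/
theorem contMDiffAt_partial_chart (f : SmoothFun n M) {x₀ y : M}
    (hy : y ∈ (chartAt (EuclideanSpace ℝ (Fin n)) x₀).source) (v : EuclideanSpace ℝ (Fin n)) :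
    ContMDiffAt (𝓡 n) 𝓘(ℝ, ℝ) ∞ (fun z => fderiv ℝ
      (f ∘ (chartAt (EuclideanSpace ℝ (Fin n)) x₀).symm)
      (chartAt (EuclideanSpace ℝ (Fin n)) x₀ z) v) y := by
  have h1 : ContDiffAt ℝ ∞ (f ∘ (chartAt (EuclideanSpace ℝ (Fin n)) x₀).symm)
      (chartAt (EuclideanSpace ℝ (Fin n)) x₀ y) :=
    (WeilBundle.smoothNear_comp (WeilBundle.smoothNear_chart_symm
      (OpenPartialHomeomorph.map_source _ hy))
        (WeilBundle.smoothNear_coe f _)).self_of_nhds.contDiffAt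
  have h2 : ContDiffAt ℝ ∞ (fun w => fderiv ℝ
      (f ∘ (chartAt (EuclideanSpace ℝ (Fin n)) x₀).symm) w v)
      (chartAt (EuclideanSpace ℝ (Fin n)) x₀ y) :=
    (h1.fderiv_right (m := ∞) (by simp)).clm_apply contDiffAt_const
  exact ContMDiffAt.comp y h2.contMDiffAt (WeilBundle.smoothNear_chart hy).self_of_nhds

/-- The coordinate vector field in the direction `v` of the chart at `x₀`, cut off by a function
`ρ` supported in the domain of the chart. -/
noncomputable def cutoffVField (x₀ : M) (ρ : SmoothFun n M)
    (hρ : tsupport ρ ⊆ (chartAt (EuclideanSpace ℝ (Fin n)) x₀).source)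
    (v : EuclideanSpace ℝ (Fin n)) : VField n M :=
  Derivation.mk'
    { toFun f := ⟨fun y => ρ y * fderiv ℝ (f ∘ (chartAt (EuclideanSpace ℝ (Fin n)) x₀).symm)
          (chartAt (EuclideanSpace ℝ (Fin n)) x₀ y) v,
        contMDiff_of_tsupport fun y hy => (ρ.contMDiff y).mul
          (contMDiffAt_partial_chart f (hρ (tsupport_mul_subset_left hy)) v)⟩
      map_add' f g := by
        ext y
        change ρ y * _ = ρ y * _ + ρ y * _
        by_cases hy : y ∈ tsupport ρ
        · have := fderiv_add (differentiableAt_comp_chart_symm f (hρ hy))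
            (differentiableAt_comp_chart_symm g (hρ hy))
          rw [← mul_add]
          exact congrArg (fun L => ρ y * L v) this
        · simp [image_eq_zero_of_notMem_tsupport hy]
      map_smul' c f := by
        ext y
        change ρ y * _ = c * (ρ y * _)
        by_cases hy : y ∈ tsupport ρ
        · have := fderiv_const_smul (differentiableAt_comp_chart_symm f (hρ hy)) c
          rw [mul_left_comm]
          exact congrArg (fun L => ρ y * L v) this
        · simp [image_eq_zero_of_notMem_tsupport hy] }
    fun f g => by
      ext y
      change ρ y * _ = f y * (ρ y * _) + g y * (ρ y * _)
      by_cases hy : y ∈ tsupport ρ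
      · have := fderiv_mul (differentiableAt_comp_chart_symm f (hρ hy))
          (differentiableAt_comp_chart_symm g (hρ hy))
        refine (congrArg (fun L => ρ y * L v) this).trans ?_
        simp [OpenPartialHomeomorph.left_inv _ (hρ hy)]
        ring
      · simp [image_eq_zero_of_notMem_tsupport hy]

theorem cutoffVField_apply (x₀ : M) (ρ : SmoothFun n M)
    (hρ : tsupport ρ ⊆ (chartAt (EuclideanSpace ℝ (Fin n)) x₀).source)
    (v : EuclideanSpace ℝ (Fin n)) (f : SmoothFun n M) (y : M) :
    cutoffVField x₀ ρ hρ v f y =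
      ρ y * fderiv ℝ (f ∘ (chartAt (EuclideanSpace ℝ (Fin n)) x₀).symm)
        (chartAt (EuclideanSpace ℝ (Fin n)) x₀ y) v := rfl

variable [T2Space M]

theorem exists_localFrame (x : M) : ∃ F : LocalFrame n M, x ∈ F.dom := by
  have hx := mem_chart_source (EuclideanSpace ℝ (Fin n)) x
  obtain ⟨ρ, h1, h2⟩ := exists_bump (n := n)
    ((chartAt (EuclideanSpace ℝ (Fin n)) x).open_source.mem_nhds hx)
  choose c hc using fun i => exists_smooth_eventuallyEq (WeilBundle.smoothNear_chart_coord hx i)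
  -- Near `x` the cut-off objects agree with the coordinates and coordinate fields of the chart.
  have hev : ∀ᶠ y in 𝓝 x, y ∈ (chartAt (EuclideanSpace ℝ (Fin n)) x).source ∧ ρ y = 1 ∧
      ∀ i, c i y = chartAt (EuclideanSpace ℝ (Fin n)) x y i := by
    filter_upwards [(chartAt (EuclideanSpace ℝ (Fin n)) x).open_source.mem_nhds hx, h1,
      Filter.eventually_all.2 hc] with y h3 h4 h5
    exact ⟨h3, h4, h5⟩
  obtain ⟨U, hU, hUo, hxU⟩ := eventually_nhds_iff.1 hev
  refine ⟨⟨U, hUo, c, fun i => cutoffVField x ρ h2 (EuclideanSpace.single i 1), ?_, ?_⟩, hxU⟩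
  · intro y hy i j
    have hys := (hU y hy).1
    have h3 : c j ∘ (chartAt (EuclideanSpace ℝ (Fin n)) x).symm
        =ᶠ[𝓝 (chartAt (EuclideanSpace ℝ (Fin n)) x y)]
        (EuclideanSpace.proj j : EuclideanSpace ℝ (Fin n) →L[ℝ] ℝ) := by
      filter_upwards [((chartAt (EuclideanSpace ℝ (Fin n)) x).continuousAt_symm
          (OpenPartialHomeomorph.map_source _ hys)).preimage_mem_nhds (by
            rw [OpenPartialHomeomorph.left_inv _ hys]; exact hUo.mem_nhds hy),
        (chartAt (EuclideanSpace ℝ (Fin n)) x).open_target.mem_nhds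
          (OpenPartialHomeomorph.map_source _ hys)] with z hz hz'
      rw [Function.comp_apply, (hU _ hz).2.2 j, OpenPartialHomeomorph.right_inv _ hz']
      rfl
    rw [cutoffVField_apply, h3.fderiv_eq, ContinuousLinearMap.fderiv, (hU y hy).2.1, one_mul]
    simp [eq_comm]
  · intro y hy f
    have hys := (hU y hy).1
    obtain ⟨F, hF⟩ := exists_smooth_eventuallyEq (WeilBundle.smoothNear_comp
      (WeilBundle.smoothNear_chart_symm (OpenPartialHomeomorph.map_source _ hys))
      (WeilBundle.smoothNear_coe f _))
    obtain ⟨G, hG, hFG⟩ := exists_smooth_sub_eq F.contMDiff.contDiff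
      (chartAt (EuclideanSpace ℝ (Fin n)) x y)
    choose g hg using fun i => exists_smooth_eventuallyEq (WeilBundle.smoothNear_comp
      (WeilBundle.smoothNear_chart hys) (WeilBundle.smoothNear_coe
        (⟨G i, (hG i).contMDiff⟩ : SmoothFun n (EuclideanSpace ℝ (Fin n))) _))
    have hFy := hF.eq_of_nhds
    rw [Function.comp_apply, OpenPartialHomeomorph.left_inv _ hys] at hFy
    refine ⟨g, ?_⟩
    filter_upwards [hUo.mem_nhds hy, Filter.eventually_all.2 hg,
      ((chartAt (EuclideanSpace ℝ (Fin n)) x).continuousAt hys).eventually hF] with z hz h3 h4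
    rw [Function.comp_apply, OpenPartialHomeomorph.left_inv _ (hU z hz).1] at h4
    change f z = f y + (∑ i, (c i - algebraMap ℝ (SmoothFun n M) (c i y)) * g i) z
    rw [SmoothFun.sum_apply, ← h4, hFG, hFy]
    congr 1
    refine Finset.sum_congr rfl fun i _ => ?_
    change _ = (c i z - c i y) * g i z
    rw [(hU z hz).2.2, (hU y hy).2.2, h3]
    rfl

end LocalFrame

/-! ### Derivations over a near point -/

section DerivationOver

variable {n : ℕ} {M : Type*} [TopologicalSpace M] [ChartedSpace (EuclideanSpace ℝ (Fin n)) M]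
  {A : Type*} [CommRing A] [Algebra ℝ A] [WeilAlgebra A]

namespace WeilBundle

/-- `D` is a derivation `C^∞(M) → A` over the algebra morphism `ξ`. -/
def IsDerivOver (ξ : WeilBundle n M A) (D : SmoothFun n M →ₗ[ℝ] A) : Prop :=
  ∀ f g, D (f * g) = ξ.toAlgHom f * D g + D f * ξ.toAlgHom g

theorem IsDerivOver.map_algebraMap {ξ : WeilBundle n M A} {D : SmoothFun n M →ₗ[ℝ] A}
    (hD : ξ.IsDerivOver D) (r : ℝ) : D (algebraMap ℝ _ r) = 0 := by
  have h := hD 1 1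
  rw [map_one, one_mul, one_mul, mul_one, left_eq_add] at h
  rw [Algebra.algebraMap_eq_smul_one, map_smul, h, smul_zero]

variable [IsManifold (𝓡 n) ∞ M] [T2Space M]

/-- Derivations over `ξ` are local at the origin of `ξ`. -/
theorem IsDerivOver.congr_germ {ξ : WeilBundle n M A} {D : SmoothFun n M →ₗ[ℝ] A}
    (hD : ξ.IsDerivOver D) {f g : SmoothFun n M} (h : f =ᶠ[𝓝 ξ.base] g) : D f = D g := by
  obtain ⟨ρ, h1, h2⟩ := exists_bump (n := n) h
  have h3 : ρ * (f - g) = 0 := by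
    ext y
    change ρ y * (f y - g y) = 0
    by_cases hy : y ∈ tsupport ρ
    · rw [show f y = g y from h2 hy]; simp
    · rw [image_eq_zero_of_notMem_tsupport hy]; simp
  have h4 : IsUnit (ξ.toAlgHom ρ) := WeilAlgebra.isUnit_of_re (by
    rw [re_apply, h1.eq_of_nhds]; simp)
  have h5 := hD ρ (f - g)
  rw [h3, map_zero, map_sub ξ.toAlgHom, ξ.congr_germ h, sub_self, mul_zero, add_zero] at h5
  rw [← sub_eq_zero, ← map_sub]
  exact h4.mul_right_eq_zero.1 h5.symm

/-- By Hadamard's lemma, if `D` kills the coordinates and has values in `𝔪ᵏ`, then it has values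
in `𝔪ᵏ⁺¹`; as `𝔪` is nilpotent, `D` vanishes. -/
theorem IsDerivOver.eq_zero {ξ : WeilBundle n M A} {D : SmoothFun n M →ₗ[ℝ] A}
    (hD : ξ.IsDerivOver D) (F : LocalFrame n M) (hξ : ξ.base ∈ F.dom)
    (h0 : ∀ i, D (F.coord i) = 0) : D = 0 := by
  have key : ∀ (k : ℕ) (f : SmoothFun n M), D f ∈ IsLocalRing.maximalIdeal A ^ k := by
    intro k
    induction k with
    | zero => intro f; simp
    | succ k ih =>
      intro f
      obtain ⟨g, hg⟩ := F.hadamard _ hξ f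
      rw [hD.congr_germ hg, map_add, hD.map_algebraMap, zero_add, map_sum]
      refine Ideal.sum_mem _ fun i _ => ?_
      rw [hD, map_sub D, h0, hD.map_algebraMap, sub_zero, zero_mul, add_zero, pow_succ']
      refine Ideal.mul_mem_mul ?_ (ih _)
      rw [map_sub, AlgHom.commutes, WeilAlgebra.sub_mem_iff, re_apply]
  obtain ⟨N, hN⟩ := WeilAlgebra.exists_pow_eq_bot (A := A)
  ext f
  have := key N f
  rwa [hN] at this

/-- A derivation over a near point is the combination of the frame with its values on the
coordinates as coefficients. -/
theorem IsDerivOver.eq_sum {ξ : WeilBundle n M A} {D : SmoothFun n M →ₗ[ℝ] A}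
    (hD : ξ.IsDerivOver D) (F : LocalFrame n M) (hξ : ξ.base ∈ F.dom) (f : SmoothFun n M) :
    D f = ∑ i, D (F.coord i) * ξ.toAlgHom (F.vf i f) := by
  let D' : SmoothFun n M →ₗ[ℝ] A :=
    ∑ i, (LinearMap.mulLeft ℝ (D (F.coord i))) ∘ₗ ξ.toAlgHom.toLinearMap ∘ₗ (F.vf i).toLinearMap
  have hD'_apply : ∀ f, D' f = ∑ i, D (F.coord i) * ξ.toAlgHom (F.vf i f) := fun f => by
    simp [D']
  have hD' : ξ.IsDerivOver (D - D') := by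
    intro f g
    simp only [LinearMap.sub_apply, hD f g, hD'_apply, Derivation.leibniz, smul_eq_mul, map_add,
      map_mul, mul_sub, sub_mul, Finset.mul_sum, Finset.sum_mul, mul_add, Finset.sum_add_distrib]
    rw [add_sub_add_comm]
    congr 2 <;> exact Finset.sum_congr rfl fun i _ => by ring
  have h := hD'.eq_zero F hξ fun j => by
    have hδ : ∀ i, ξ.toAlgHom (F.vf i (F.coord j)) = if i = j then 1 else 0 := by
      intro i
      have : F.vf i (F.coord j) =ᶠ[𝓝 ξ.base]
          (if i = j then 1 else 0 : SmoothFun n M) := by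
        filter_upwards [F.isOpen_dom.mem_nhds hξ] with y hy
        rw [F.vf_coord y hy]
        split_ifs <;> rfl
      rw [ξ.congr_germ this]
      split_ifs <;> simp
    simp [hD'_apply, hδ]
  rw [← hD'_apply, ← sub_eq_zero, ← LinearMap.sub_apply, h, LinearMap.zero_apply]

end WeilBundle

variable [IsManifold (𝓡 n) ∞ M] [T2Space M]

/-- The real numbers are a Weil algebra, with maximal ideal `0`. -/
instance : WeilAlgebra ℝ where
  finiteDimensional := inferInstance
  isLocalRing := inferInstance
  codim_one := Algebra.finrank_eq_one_iff_bijective_algebraMap.2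
    ⟨(algebraMap ℝ _).injective, Ideal.Quotient.mk_surjective⟩

/-- Points of `M` are near points of kind `ℝ`, so vector fields on `M` expand in a local frame. -/
theorem LocalFrame.apply_eq_sum (F : LocalFrame n M) {y : M} (hy : y ∈ F.dom) (θ : VField n M)
    (f : SmoothFun n M) : θ f y = ∑ i, θ (F.coord i) y * F.vf i f y := by
  have hb : (WeilBundle.pointEval (n := n) ℝ y).base = y :=
    WeilBundle.base_eq _ fun f => WeilAlgebra.re_algebraMap (f y)
  let D : SmoothFun n M →ₗ[ℝ] ℝ :=
    (WeilBundle.pointEval (n := n) ℝ y).toAlgHom.toLinearMap ∘ₗ θ.toLinearMap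
  have hD : (WeilBundle.pointEval (n := n) ℝ y).IsDerivOver D := by
    intro f g
    change (WeilBundle.pointEval (n := n) ℝ y).toAlgHom (θ (f * g)) =
      _ * (WeilBundle.pointEval (n := n) ℝ y).toAlgHom (θ g) +
        (WeilBundle.pointEval (n := n) ℝ y).toAlgHom (θ f) * _
    rw [θ.leibniz, map_add, smul_eq_mul, smul_eq_mul, map_mul, map_mul]
    ring
  exact hD.eq_sum F (by rwa [hb]) f

end DerivationOver

/-! ### Forms in a local frame -/

/-- If the arguments of a multilinear map are, after multiplication by `ρ`, combinations of the
vectors `E i`, then so is its value, after multiplication by a power of `ρ`. For `ρ` a bump function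
this says that multilinear maps of modules of sections are local. -/
theorem MultilinearMap.pow_smul_apply_eq_sum {S V W ι : Type*} [CommRing S] [AddCommGroup V]
    [Module S V] [AddCommGroup W] [Module S W] [Fintype ι] {p : ℕ}
    (η : MultilinearMap S (fun _ : Fin p => V) W) (ρ : S) (X : Fin p → V) (E : ι → V)
    (c : Fin p → ι → S) (h : ∀ k, ρ • X k = ρ • ∑ i, c k i • E i) :
    ρ ^ p • η X = ρ ^ p • ∑ I : Fin p → ι, (∏ k, c k (I k)) • η fun k => E (I k) := by
  classical
  have h1 : ∀ Y : Fin p → V, ρ ^ p • η Y = η fun k => ρ • Y k := fun Y => by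
    rw [η.map_smul_univ (fun _ => ρ) Y, Finset.prod_const, Finset.card_univ, Fintype.card_fin]
  have h2 : (η fun k => ∑ i, c k i • E i) =
      ∑ I : Fin p → ι, (∏ k, c k (I k)) • η fun k => E (I k) := by
    rw [η.map_sum fun k i => c k i • E i]
    exact Finset.sum_congr rfl fun I _ => η.map_smul_univ (fun k => c k (I k)) fun k => E (I k)
  rw [← h2, h1, h1]
  simp only [h]

theorem Derivation.finsetSum_apply {k R V ι : Type*} [CommSemiring k] [CommSemiring R]
    [AddCommMonoid V] [Algebra k R] [Module R V] [Module k V] (s : Finset ι)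
    (D : ι → Derivation k R V) (f : R) : (∑ i ∈ s, D i) f = ∑ i ∈ s, D i f := by
  change Derivation.coeFnAddMonoidHom (∑ i ∈ s, D i) f = _
  rw [map_sum, Finset.sum_apply]
  rfl

section Forms

open WeilBundle

variable {n : ℕ} {M : Type*} [TopologicalSpace M] [ChartedSpace (EuclideanSpace ℝ (Fin n)) M]
  [IsManifold (𝓡 n) ∞ M] [T2Space M]
  {A : Type*} [NormedCommRing A] [NormedAlgebra ℝ A] [WeilAlgebra A]

variable (n M) in
/-- Evaluation of smooth `A`-valued functions on `M^A` at a near point. -/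
noncomputable def WeilBundle.evalA (ξ : WeilBundle n M A) : SmoothFunA n M A →+* A :=
  ContMDiffMap.evalRingHom ξ

theorem WeilBundle.evalA_apply (ξ : WeilBundle n M A) (φ : SmoothFunA n M A) :
    ξ.evalA n M φ = φ ξ := rfl

theorem WeilBundle.evalA_prolongFun (ξ : WeilBundle n M A) (f : SmoothFun n M) :
    ξ.evalA n M (prolongFun f) = ξ.toAlgHom f := rfl

/-- A vector field on `M^A`, evaluated at a near point `ξ`, is a derivation over `ξ`. -/
theorem VFieldA_isDerivOver (X : VFieldA n M A) (ξ : WeilBundle n M A) :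
    ξ.IsDerivOver
      { toFun f := X f ξ
        map_add' f g := by rw [map_add]; rfl
        map_smul' c f := by rw [X.map_smul]; rfl } := by
  intro f g
  change X (f * g) ξ = ξ.toAlgHom f * X g ξ + X f ξ * ξ.toAlgHom g
  rw [VFieldA_leibniz, add_comm]
  rfl

theorem LocalFrame.VFieldA_apply_eq_sum (F : LocalFrame n M) {ξ : WeilBundle n M A}
    (hξ : ξ.base ∈ F.dom) (X : VFieldA n M A) (f : SmoothFun n M) :
    X f ξ = ∑ i, X (F.coord i) ξ * ξ.toAlgHom (F.vf i f) :=
  (VFieldA_isDerivOver X ξ).eq_sum F hξ f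

theorem WeilBundle.apply_eq_zero_of_base_notMem (ξ : WeilBundle n M A) {ρ : SmoothFun n M}
    (h : ξ.base ∉ tsupport ρ) : ξ.toAlgHom ρ = 0 := by
  rw [← map_zero ξ.toAlgHom]
  exact ξ.congr_germ (notMem_tsupport_iff_eventuallyEq.1 h)

theorem LocalFrame.smul_vfield (F : LocalFrame n M) {ρ : SmoothFun n M}
    (hρ : tsupport ρ ⊆ F.dom) (θ : VField n M) :
    ρ • θ = ρ • ∑ i, θ (F.coord i) • F.vf i := by
  ext f y
  rw [Derivation.smul_apply, Derivation.smul_apply, Derivation.finsetSum_apply]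
  change ρ y * θ f y = ρ y * (∑ i, (θ (F.coord i) • F.vf i) f) y
  rw [SmoothFun.sum_apply]
  by_cases hy : y ∈ tsupport ρ
  · rw [F.apply_eq_sum (hρ hy)]
    rfl
  · simp [image_eq_zero_of_notMem_tsupport hy]

/-- Over the domain of a local frame, the prolonged frame generates the vector fields on `M^A`. -/
theorem LocalFrame.smul_vfieldA (F : LocalFrame n M) {ρ : SmoothFun n M}
    (hρ : tsupport ρ ⊆ F.dom) (X : VFieldA n M A) :
    (prolongFun ρ : SmoothFunA n M A) • X =
      (prolongFun ρ : SmoothFunA n M A) • ∑ i, X (F.coord i) • prolongVField (F.vf i) := by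
  ext f ξ
  rw [Derivation.smul_apply, Derivation.smul_apply, Derivation.finsetSum_apply]
  change ξ.toAlgHom ρ * X f ξ = ξ.toAlgHom ρ *
    ξ.evalA n M (∑ i, (X (F.coord i) • prolongVField (F.vf i)) f)
  by_cases hξ : ξ.base ∈ tsupport ρ
  · rw [F.VFieldA_apply_eq_sum (hρ hξ), map_sum]
    rfl
  · rw [ξ.apply_eq_zero_of_base_notMem hξ, zero_mul, zero_mul]

/-- The value of an `A`-form at a near point `ξ` is determined by its values on the prolongation
of a local frame around the origin of `ξ`. -/
theorem LocalFrame.DFormA_apply_eq_sum (F : LocalFrame n M) {ξ : WeilBundle n M A}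
    (hξ : ξ.base ∈ F.dom) {p : ℕ} (η : DFormA n M A p) (X : Fin p → VFieldA n M A) :
    η X ξ = ∑ I : Fin p → Fin n, (∏ k, X k (F.coord (I k)) ξ) *
      η (fun k => prolongVField (F.vf (I k))) ξ := by
  -- A bump function `ρ` around the origin of `ξ` has `ξ(ρ) = 1`, so the factors `ρ` drop out at `ξ`.
  obtain ⟨ρ, h1, h2⟩ := exists_bump (n := n) (F.isOpen_dom.mem_nhds hξ)
  have hρ : ξ.toAlgHom ρ = 1 := by
    rw [← map_one ξ.toAlgHom]
    exact ξ.congr_germ h1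
  have h := congrArg (ξ.evalA n M) (η.toMultilinearMap.pow_smul_apply_eq_sum
    (prolongFun ρ : SmoothFunA n M A) X _ _ fun k => F.smul_vfieldA h2 (X k))
  simp only [smul_eq_mul, map_mul, map_pow, evalA_prolongFun, hρ, one_pow, one_mul, map_sum,
    map_prod] at h
  exact h

theorem LocalFrame.apply_DForm_eq_sum (F : LocalFrame n M) {ξ : WeilBundle n M A}
    (hξ : ξ.base ∈ F.dom) {p : ℕ} (α : DForm n M p) (θ : Fin p → VField n M) :
    ξ.toAlgHom (α θ) = ∑ I : Fin p → Fin n, (∏ k, ξ.toAlgHom (θ k (F.coord (I k)))) *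
      ξ.toAlgHom (α fun k => F.vf (I k)) := by
  -- A bump function `ρ` around the origin of `ξ` has `ξ(ρ) = 1`, so the factors `ρ` drop out at `ξ`.
  obtain ⟨ρ, h1, h2⟩ := exists_bump (n := n) (F.isOpen_dom.mem_nhds hξ)
  have hρ : ξ.toAlgHom ρ = 1 := by
    rw [← map_one ξ.toAlgHom]
    exact ξ.congr_germ h1
  have h := congrArg ξ.toAlgHom (α.toMultilinearMap.pow_smul_apply_eq_sum
    ρ θ _ _ fun k => F.smul_vfield h2 (θ k))
  simp only [smul_eq_mul, map_mul, map_pow, hρ, one_pow, one_mul, map_sum, map_prod] at h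
  exact h

/-- A form has at most one prolongation. -/
theorem IsProlongForm.unique {p : ℕ} {α : DForm n M p} {η η' : DFormA n M A p}
    (h : IsProlongForm α η) (h' : IsProlongForm α η') : η = η' := by
  ext X ξ
  obtain ⟨F, hF⟩ := exists_localFrame (n := n) ξ.base
  rw [F.DFormA_apply_eq_sum hF, F.DFormA_apply_eq_sum hF η']
  refine Finset.sum_congr rfl fun I _ => ?_
  rw [h, h']

/-! ### Existence of the prolongation -/

/-- The `A`-form `∑_I α(e_I)^A ∏ₖ dx_{I k}` on `M^A`, where `x` are the coordinates and `e` the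
vector fields of a local frame: it represents the prolongation of `α` over the domain of the
frame. -/
noncomputable def LocalFrame.localForm (F : LocalFrame n M) (A : Type*) [NormedCommRing A]
    [NormedAlgebra ℝ A] [WeilAlgebra A] {p : ℕ} (α : DForm n M p) : DFormA n M A p :=
  { (∑ I : Fin p → Fin n, (prolongFun (α fun k => F.vf (I k)) : SmoothFunA n M A) •
      (MultilinearMap.mkPiAlgebra (SmoothFunA n M A) (Fin p) (SmoothFunA n M A)).compLinearMap
        fun k =>
          ({ toFun X := X (F.coord (I k))
             map_add' _ _ := rfl
             map_smul' _ _ := rfl } : VFieldA n M A →ₗ[SmoothFunA n M A] SmoothFunA n M A)) with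
    map_eq_zero_of_eq' X k l hX hkl := by
      simp only [MultilinearMap.toFun_eq_coe, sum_apply, smul_apply,
        MultilinearMap.compLinearMap_apply, MultilinearMap.mkPiAlgebra_apply, LinearMap.coe_mk,
        AddHom.coe_mk, smul_eq_mul]
      set S := ∑ I : Fin p → Fin n, (prolongFun (α fun k => F.vf (I k)) : SmoothFunA n M A) *
        ∏ m, X m (F.coord (I m)) with hS
      -- Exchanging the indices `k` and `l` of `I` changes the sign of the sum.
      have h1 : S = -S := by
        conv_lhs => rw [hS, ← Equiv.sum_comp ((Equiv.swap k l).arrowCongr (Equiv.refl (Fin n)))]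
        rw [hS, ← Finset.sum_neg_distrib]
        refine Finset.sum_congr rfl fun I _ => ?_
        have h2 : (α fun m => F.vf (I (Equiv.swap k l m))) = -α fun m => F.vf (I m) :=
          α.map_swap (fun m => F.vf (I m)) hkl
        have h3 : ∏ m, X m (F.coord (I (Equiv.swap k l m))) = ∏ m, X m (F.coord (I m)) := by
          rw [← Equiv.prod_comp (Equiv.swap k l)]
          refine Finset.prod_congr rfl fun m _ => ?_
          rw [Equiv.swap_apply_self, Equiv.apply_swap_eq_self hX]
        simp only [Equiv.arrowCongr_apply, Equiv.symm_swap, Equiv.coe_refl, Function.comp_apply,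
          id_eq, h2, h3, map_neg, neg_mul]
      -- `C^∞(M^A, A)` is a real algebra, so `2` can be cancelled.
      have h2 : (2 : ℝ) • S = 0 := by
        rw [two_smul]
        nth_rewrite 1 [h1]
        exact neg_add_cancel S
      exact (smul_eq_zero_iff_right (two_ne_zero' ℝ)).1 h2 }

theorem LocalFrame.localForm_apply (F : LocalFrame n M) {p : ℕ} (α : DForm n M p)
    (X : Fin p → VFieldA n M A) (ξ : WeilBundle n M A) :
    F.localForm A α X ξ = ∑ I : Fin p → Fin n, (∏ k, X k (F.coord (I k)) ξ) *
      ξ.toAlgHom (α fun k => F.vf (I k)) := by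
  have h : F.localForm A α X = ∑ I : Fin p → Fin n,
      (prolongFun (α fun k => F.vf (I k)) : SmoothFunA n M A) * ∏ m, X m (F.coord (I m)) := by
    change (MultilinearMap.toFun _ X : SmoothFunA n M A) = _
    simp [localForm]
  rw [h, ← evalA_apply]
  simp only [map_sum, map_mul, map_prod]
  exact Finset.sum_congr rfl fun I _ => mul_comm _ _

/-- Over the domain of the frame, the local representative has the property which defines the
prolongation. -/
theorem LocalFrame.localForm_prolong (F : LocalFrame n M) {p : ℕ} (α : DForm n M p)
    {ξ : WeilBundle n M A} (hξ : ξ.base ∈ F.dom) (θ : Fin p → VField n M) :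
    F.localForm A α (fun k => prolongVField (θ k)) ξ = ξ.toAlgHom (α θ) := by
  rw [localForm_apply, F.apply_DForm_eq_sum hξ]
  rfl

/-- The local representatives in two frames agree over the intersection of their domains: expand
the first one in the second frame. -/
theorem LocalFrame.localForm_eq (F G : LocalFrame n M) {p : ℕ} (α : DForm n M p)
    {ξ : WeilBundle n M A} (hF : ξ.base ∈ F.dom) (hG : ξ.base ∈ G.dom)
    (X : Fin p → VFieldA n M A) : F.localForm A α X ξ = G.localForm A α X ξ := by
  rw [G.DFormA_apply_eq_sum hG, G.localForm_apply]
  exact Finset.sum_congr rfl fun I _ => by rw [F.localForm_prolong α hF]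

theorem WeilBundle.continuous_base : Continuous (base : WeilBundle n M A → M) := by
  refine continuous_iff_continuousAt.2 fun ξ s hs => ?_
  obtain ⟨ρ, h1, h2⟩ := exists_bump (n := n) hs
  have hc : Continuous fun ζ : WeilBundle n M A => WeilAlgebra.re A (ζ.toAlgHom ρ) :=
    (WeilAlgebra.contDiff_re (A := A)).continuous.comp (contMDiff_prolong ρ).continuous
  have hne : WeilAlgebra.re A (ξ.toAlgHom ρ) ≠ 0 := by
    rw [re_apply, h1.eq_of_nhds]; simp
  rw [Filter.mem_map]
  filter_upwards [hc.continuousAt.eventually_ne hne] with ζ hζ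
  rw [re_apply] at hζ
  exact h2 (subset_tsupport _ hζ)

/-- Every form has a prolongation: its local representatives do not depend on the frame. -/
theorem exists_isProlongForm {p : ℕ} (α : DForm n M p) :
    ∃ η : DFormA n M A p, IsProlongForm α η := by
  choose F hF using exists_localFrame (n := n) (M := M)
  -- At `ξ`, use the frame chosen at the origin of `ξ`; near `ξ` the value is also that of the fixed
  -- smooth form given by the frame at the origin of `ξ`.
  let η (X : Fin p → VFieldA n M A) : SmoothFunA n M A :=
    ⟨fun ξ => (F ξ.base).localForm A α X ξ, fun ξ =>
      ((F ξ.base).localForm A α X).contMDiff.contMDiffAt.congr_of_eventuallyEq (by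
        filter_upwards [continuous_base.continuousAt.preimage_mem_nhds
          ((F ξ.base).isOpen_dom.mem_nhds (hF ξ.base))] with ζ hζ
        exact (F ζ.base).localForm_eq (F ξ.base) α (hF _) hζ X)⟩
  have hη : ∀ X ξ, η X ξ = (F ξ.base).localForm A α X ξ := fun _ _ => rfl
  refine ⟨{ toFun := η, map_update_add' := ?_, map_update_smul' := ?_, map_eq_zero_of_eq' := ?_ },
    fun θ => ?_⟩
  · intro _ X i Y Z
    ext ξ
    change _ = η _ ξ + η _ ξ
    rw [hη, hη, hη, AlternatingMap.map_update_add]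
    rfl
  · intro _ X i c Y
    ext ξ
    change _ = c ξ * η _ ξ
    rw [hη, hη, AlternatingMap.map_update_smul]
    rfl
  · intro X i j hX hij
    ext ξ
    rw [hη, AlternatingMap.map_eq_zero_of_eq _ X hX hij]
  · ext ξ
    exact (F ξ.base).localForm_prolong α (hF _) θ

theorem isProlongForm_prolongForm {p : ℕ} (α : DForm n M p) :
    IsProlongForm α (prolongForm A α) := by
  rw [prolongForm, dif_pos (exists_isProlongForm α)]
  exact (exists_isProlongForm α).choose_spec

/-! ### Interior multiplication -/

/-- Contracting a prolongation of `α` with `θ^A` gives a prolongation of `i_θ α`: the defining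
property for `θ₁, …` is that of `α^A` for `θ, θ₁, …`. -/
theorem IsProlongForm.interiorMul (θ : VField n M) {p : ℕ} {α : DForm n M p}
    {η : DFormA n M A p} (h : IsProlongForm α η) :
    IsProlongForm (interiorMul θ α) (interiorMul (prolongVField θ) η) := by
  intro θs
  cases p with
  | zero =>
    -- In degree `0` both contractions are zero by definition.
    exact (map_zero prolongFun).symm
  | succ p =>
    have h' := h (Fin.cons θ θs)
    refine Eq.trans ?_ h'
    change η (Matrix.vecCons _ _) = _
    congr 1
    ext1 i
    refine Fin.cases ?_ (fun j => ?_) i <;> rfl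

end Forms

/-- Prolongation of differential forms to the Weil bundle `M^A` is well defined and commutes with
interior multiplication: `(i_θ α)^A = i_{θ^A} (α^A)`. -/
theorem mainTheorem8 {n : ℕ} {M : Type*} [TopologicalSpace M]
    [ChartedSpace (EuclideanSpace ℝ (Fin n)) M] [IsManifold (𝓡 n) ∞ M] [T2Space M]
    [ParacompactSpace M]
    {A : Type*} [NormedCommRing A] [NormedAlgebra ℝ A] [WeilAlgebra A]
    {p : ℕ} (α : DForm n M p) (θ : VField n M) :
    (∃! η : DFormA n M A p, IsProlongForm α η) ∧
    (∃! η : DFormA n M A (p - 1), IsProlongForm (interiorMul θ α) η) ∧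
    IsProlongForm α (prolongForm A α) ∧
    IsProlongForm (interiorMul θ α) (prolongForm A (interiorMul θ α)) ∧
    prolongForm A (interiorMul θ α) = interiorMul (prolongVField θ) (prolongForm A α) := by
  have h1 := isProlongForm_prolongForm (A := A) α
  have h2 := isProlongForm_prolongForm (A := A) (interiorMul θ α)
  exact ⟨⟨_, h1, fun _ h => h.unique h1⟩, ⟨_, h2, fun _ h => h.unique h2⟩, h1, h2,
    h2.unique (h1.interiorMul θ)⟩
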